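/- Let $1\le p\le\infty$, let $p^*$ be the conjugate exponent, let $X$ be a real Banach lattice and $E$ a real Banach space. A bounded operator $T:X\to E$ is *positively $p$-nuclear* if there are positive functionals $x_n^*\in X^*$ and vectors $u_n\in E$ with $Tx=\sum_n x_n^*(x)\,u_n$ for all $x\in X$, $$\|(x_n^*)\|^w_{p^*}=\sup_{\varphi\in B_{X^{**}}}\|(\varphi(x_n^*))_n\|_{\ell_{p^*}}<\infty,\qquad \|(u_n)\|_p=\big\|(\|u_n\|)_n\big\|_{\ell_p}<\infty .$$ Its *positively $p$-nuclear norm* $\widetilde\nu^p(T)$ is the infimum of $\|(x_n^*)\|^w_{p^*}\|(u_n)\|_p$ over all such representations. The class of these operators is $\widetilde{\mathcal N}^p(X,E)$. A bounded operator $T:X\to E$ is *positively $p$-integral*, $T\in\widetilde{\mathcal I}^p(X,E)$, if there is a constant $C>0$ such that for every Banach lattice $Y$, every Banach space $F$, every positive finite rank operator $S:Y\to X$ and every finite rank operator $R:E\to F$, the operator $RTS$ is positively $p$-nuclear and $\widetilde\nu^p(RTS)\le C\|R\|\|S\|$. The infimum of such $C$ is the *positively $p$-integral norm* $\widetilde i^p(T)$.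 $E$ has the *metric approximation property* (MAP) if for every $\varepsilon>0$ and every compact $K\subset E$ there is a finite rank operator $S:E\to E$ with $\|S\|\le1$ and $\|Su-u\|<\varepsilon$ for all $u\in K$. A Banach lattice has the *positive metric approximation property* (PMAP) if the same holds with $S$ in addition positive. **Theorem 3.4.** Suppose that the dual Banach lattice $X^*$ has the PMAP and that $E$ has the MAP. Then every $T\in\widetilde{\mathcal N}^p(X,E)$ belongs to $\widetilde{\mathcal I}^p(X,E)$, and $$\widetilde\nu^p(T)=\widetilde i^p(T).$$ That is, $\widetilde{\mathcal N}^p(X,E)$ is contained in $\widetilde{\mathcal I}^p(X,E)$ and the inclusion preserves the norms. -/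

import Mathlib

open scoped ENNReal

universe u v

namespace PosNuclear

noncomputable section

/-- `T` has finite rank. -/
def FiniteRank {V W : Type*} [NormedAddCommGroup V] [NormedSpace ℝ V]
    [NormedAddCommGroup W] [NormedSpace ℝ W] (T : V →L[ℝ] W) : Prop :=
  FiniteDimensional ℝ (LinearMap.range (T : V →ₗ[ℝ] W))

/-- The positive cone `{x | 0 ≤ x}` of an ordered space. -/
def posCone (X : Type*) [Zero X] [LE X] : Set X := {x | 0 ≤ x}

/-- The positive cone of the dual Banach lattice `X*`: the functionals that are nonnegative on
the positive cone of `X`. It determines the order of `X*`. -/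
def dualPosCone (X : Type*) [NormedAddCommGroup X] [NormedSpace ℝ X] [LE X] :
    Set (StrongDual ℝ X) :=
  {f | ∀ x ∈ posCone X, 0 ≤ f x}

/-- The metric approximation property of `E`. -/
def HasMAP (E : Type*) [NormedAddCommGroup E] [NormedSpace ℝ E] : Prop :=
  ∀ ε : ℝ, 0 < ε → ∀ K : Set E, IsCompact K →
    ∃ S : E →L[ℝ] E, FiniteRank S ∧ ‖S‖ ≤ 1 ∧ ∀ x ∈ K, ‖S x - x‖ < ε

/-- The positive metric approximation property of a Banach lattice `V` with positive cone `P`: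
the approximating finite rank operators are positive, that is, map `P` into `P`. -/
def HasPMAP (V : Type*) [NormedAddCommGroup V] [NormedSpace ℝ V] (P : Set V) : Prop :=
  ∀ ε : ℝ, 0 < ε → ∀ K : Set V, IsCompact K →
    ∃ R : V →L[ℝ] V, FiniteRank R ∧ (∀ x ∈ P, R x ∈ P) ∧ ‖R‖ ≤ 1 ∧ ∀ x ∈ K, ‖R x - x‖ < ε

/-- The norm of `l_p(E)`, with value `∞` outside `l_p(E)`. For `p = ∞` it is the supremum norm. -/
def strongNorm {E : Type*} [NormedAddCommGroup E] (p : ℝ≥0∞) (a : ℕ → E) : ℝ≥0∞ :=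
  if p = ∞ then ⨆ n, ‖a n‖ₑ else (∑' n, ‖a n‖ₑ ^ p.toReal) ^ (1 / p.toReal)

/-- The norm of `l^w_p(E)`, with value `∞` outside `l^w_p(E)`. -/
def weakNorm {E : Type*} [NormedAddCommGroup E] [NormedSpace ℝ E] (p : ℝ≥0∞) (a : ℕ → E) :
    ℝ≥0∞ :=
  ⨆ (φ : StrongDual ℝ E) (_ : ‖φ‖ ≤ 1), strongNorm p (fun n => φ (a n))

/-- `T = ∑ xₙ* ⊗ uₙ` is a positively `p`-nuclear representation of `T`: the `xₙ*` are positive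
and weakly `p*`-summable, and `(uₙ)` belongs to `l_p(E)`. By Hölder's inequality the series
converges absolutely at every point. -/
structure IsPosNuclearRep {X : Type*} {E : Type*} [NormedAddCommGroup X] [NormedSpace ℝ X] [LE X]
    [NormedAddCommGroup E] [NormedSpace ℝ E] (p : ℝ≥0∞) (T : X →L[ℝ] E)
    (f : ℕ → StrongDual ℝ X) (a : ℕ → E) : Prop where
  pos : ∀ n, f n ∈ dualPosCone X
  weak_lt_top : weakNorm p.conjExponent f < ∞
  strong_lt_top : strongNorm p a < ∞
  hasSum : ∀ x, HasSum (fun n => f n x • a n) (T x)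

/-- `T` is positively `p`-nuclear. -/
def IsPosNuclear {X : Type*} {E : Type*} [NormedAddCommGroup X] [NormedSpace ℝ X] [LE X]
    [NormedAddCommGroup E] [NormedSpace ℝ E] (p : ℝ≥0∞) (T : X →L[ℝ] E) : Prop :=
  ∃ (f : ℕ → StrongDual ℝ X) (a : ℕ → E), IsPosNuclearRep p T f a

/-- The positively `p`-nuclear norm, with value `∞` if `T` is not positively `p`-nuclear. -/
def posNuclearNorm {X : Type*} {E : Type*} [NormedAddCommGroup X] [NormedSpace ℝ X] [LE X]
    [NormedAddCommGroup E] [NormedSpace ℝ E] (p : ℝ≥0∞) (T : X →L[ℝ] E) : ℝ≥0∞ :=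
  ⨅ (f : ℕ → StrongDual ℝ X) (a : ℕ → E) (_ : IsPosNuclearRep p T f a),
    weakNorm p.conjExponent f * strongNorm p a

/-- `C > 0` is a constant such that, for all Banach lattices `Y`, Banach spaces `F`, positive
finite rank `S : Y → X` and finite rank `R : E → F`, the operator `R T S` is positively
`p`-nuclear with norm at most `C ‖R‖ ‖S‖`. -/
def IsPosIntegralBound {X : Type u} {E : Type v} [NormedAddCommGroup X] [NormedSpace ℝ X] [LE X]
    [NormedAddCommGroup E] [NormedSpace ℝ E] (p : ℝ≥0∞) (T : X →L[ℝ] E) (C : ℝ) : Prop :=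
  0 < C ∧
  ∀ (Y : Type u) [NormedAddCommGroup Y] [Lattice Y] [IsOrderedAddMonoid Y] [HasSolidNorm Y]
    [NormedSpace ℝ Y] [IsOrderedModule ℝ Y] [CompleteSpace Y]
    (F : Type v) [NormedAddCommGroup F] [NormedSpace ℝ F] [CompleteSpace F]
    (S : Y →L[ℝ] X) (R : E →L[ℝ] F),
    FiniteRank S → (∀ y ∈ posCone Y, S y ∈ posCone X) → FiniteRank R →
      posNuclearNorm p (R.comp (T.comp S)) ≤ ENNReal.ofReal (C * ‖R‖ * ‖S‖)

/-- `T` is positively `p`-integral. -/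
def IsPosIntegral {X : Type u} {E : Type v} [NormedAddCommGroup X] [NormedSpace ℝ X] [LE X]
    [NormedAddCommGroup E] [NormedSpace ℝ E] (p : ℝ≥0∞) (T : X →L[ℝ] E) : Prop :=
  ∃ C : ℝ, IsPosIntegralBound p T C

/-- The positively `p`-integral norm, with value `∞` if `T` is not positively `p`-integral. -/
def posIntegralNorm {X : Type u} {E : Type v} [NormedAddCommGroup X] [NormedSpace ℝ X] [LE X]
    [NormedAddCommGroup E] [NormedSpace ℝ E] (p : ℝ≥0∞) (T : X →L[ℝ] E) : ℝ≥0∞ :=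
  ⨅ (C : ℝ) (_ : IsPosIntegralBound p T C), ENNReal.ofReal C

end

end PosNuclear

/-! One inequality is the ideal property: composing a representation `T = ∑ fₙ ⊗ aₙ` with a positive
`S` and any `R` multiplies its two norms by at most `‖S‖` and `‖R‖`. So the product of these norms,
enlarged by any `δ > 0`, is an integral bound. The substance is the converse: if `T` is already
known to be nuclear, every integral bound `C` is at least its nuclear norm.

For `p < ∞` this is a perturbation argument. The tails of `(aₙ)` are small in `ℓ_p`, so up to a
small nuclear error `T` is a finite sum `T₀`. The MAP gives `R` almost fixing the vectors of `T₀`,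
and `exists_posFiniteRank_adjoint_approx` gives a positive finite rank `S` on `X` whose adjoint
almost fixes its functionals. Then `T - RTS` has small nuclear norm, while that of `RTS` is at most
`C ‖R‖ ‖S‖`. Subadditivity of the square root of the nuclear norm suffices here. The PMAP only
provides operators on `X*`, which need not be adjoints. A positive form of local reflexivity,
obtained by Hahn–Banach separation, moves them to `X`; a small rank one correction restores
positivity.

For `p = ∞` the tails of `(aₙ)` need not be small. Instead, testing on positive maps from
finite-dimensional sup-norm spaces shows that an integral `T` is cone absolutely summing: `∑ ‖T xᵢ‖
≤ C ‖∑ xᵢ‖` for positive `xᵢ`. A nuclear representation gives `T` a vector density with respect to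
the positive functional `g = ∑ fₙ`, and the variation of this vector measure is controlled by the
summing bound. Approximating the density by countably valued functions, and repeating this on the
remainder, rewrites `T` as a series of positive rank one operators whose total weight is almost the
variation. Partitions of `x ≥ 0` into positive summands play the role of measurable partitions:
functionals such as infima are limits of totals along them. -/

open Filter Topology
open scoped NNReal

namespace PosNuclear

noncomputable section

set_option linter.unusedSectionVars false

/-! ### Positive partitions and Riesz decomposition -/

section Partitions

variable {X : Type*} [AddCommGroup X] [Lattice X]

/-- `ψ` vanishes at `0` and is subadditive on the positive cone. -/
def ConeSubadditive (ψ : X → ℝ) : Prop :=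
  ψ 0 = 0 ∧ ∀ x y, 0 ≤ x → 0 ≤ y → ψ (x + y) ≤ ψ x + ψ y

variable [IsOrderedAddMonoid X]

theorem ConeSubadditive.le_sum_map {ψ : X → ℝ} (h : ConeSubadditive ψ) (b : Multiset X) :
    (∀ y ∈ b, 0 ≤ y) → ψ b.sum ≤ (b.map ψ).sum := by
  induction b using Multiset.induction_on with
  | empty => simp [h.1]
  | cons e b ihb =>
    intro hb
    have hb' : ∀ y ∈ b, 0 ≤ y := fun y hy => hb y (Multiset.mem_cons_of_mem hy)
    simp only [Multiset.map_cons, Multiset.sum_cons]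
    exact (h.2 e b.sum (hb e (Multiset.mem_cons_self e b)) (Multiset.sum_nonneg hb')).trans
      (by linarith [ihb hb'])

/-- Riesz decomposition: a finite positive family whose sum dominates `a ≥ 0` splits into
a family with sum `a` and a family with the remaining sum. -/
theorem exists_split (t : Multiset X) : ∀ a : X, (∀ y ∈ t, 0 ≤ y) → 0 ≤ a → a ≤ t.sum →
    ∃ b c : Multiset X, (∀ y ∈ b, 0 ≤ y) ∧ (∀ y ∈ c, 0 ≤ y) ∧ b.sum = a ∧ a + c.sum = t.sum ∧
      ∀ ψ : X → ℝ, ConeSubadditive ψ → (t.map ψ).sum ≤ (b.map ψ).sum + (c.map ψ).sum := by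
  induction t using Multiset.induction_on with
  | empty =>
    intro a _ h0 ha
    have : a = 0 := le_antisymm (by simpa using ha) h0
    exact ⟨0, 0, by simp, by simp, by simp [this], by simp [this], by simp⟩
  | cons d t ih =>
    intro a ht h0 ha
    have hd : 0 ≤ d := ht d (Multiset.mem_cons_self d t)
    have ht' : ∀ y ∈ t, 0 ≤ y := fun y hy => ht y (Multiset.mem_cons_of_mem hy)
    rw [Multiset.sum_cons] at ha
    -- The first member `d` gives `a ⊓ d` to `a`; this inequality lets the remaining members cover
    -- the rest of `a`.
    have h1 : a - a ⊓ d ≤ t.sum := by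
      have hs : 0 ≤ t.sum := Multiset.sum_nonneg ht'
      rw [sub_le_iff_le_add, ← sub_le_iff_le_add']
      refine le_inf (sub_le_self _ hs) ?_
      rw [sub_le_iff_le_add]; exact ha
    obtain ⟨b, c, hb, hc, hbs, hcs, hψ⟩ := ih (a - a ⊓ d) ht' (sub_nonneg.2 inf_le_left) h1
    refine ⟨(a ⊓ d) ::ₘ b, (d - a ⊓ d) ::ₘ c, ?_, ?_, ?_, ?_, ?_⟩
    · intro y hy
      rcases Multiset.mem_cons.1 hy with rfl | hy
      · exact le_inf h0 hd
      · exact hb y hy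
    · intro y hy
      rcases Multiset.mem_cons.1 hy with rfl | hy
      · exact sub_nonneg.2 inf_le_right
      · exact hc y hy
    · rw [Multiset.sum_cons, hbs]; abel
    · rw [Multiset.sum_cons, Multiset.sum_cons, ← hcs]; abel
    · intro ψ h
      simp only [Multiset.map_cons, Multiset.sum_cons]
      have := h.2 (a ⊓ d) (d - a ⊓ d) (le_inf h0 hd) (sub_nonneg.2 inf_le_right)
      rw [add_sub_cancel] at this
      linarith [hψ ψ h]

/-- Two finite positive families with the same sum have a common refinement. -/
theorem exists_common_refinement (s : Multiset X) : ∀ t : Multiset X, (∀ y ∈ s, 0 ≤ y) →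
    (∀ y ∈ t, 0 ≤ y) → s.sum = t.sum →
    ∃ r : Multiset X, (∀ y ∈ r, 0 ≤ y) ∧ r.sum = s.sum ∧
      ∀ ψ : X → ℝ, ConeSubadditive ψ →
        (s.map ψ).sum ≤ (r.map ψ).sum ∧ (t.map ψ).sum ≤ (r.map ψ).sum := by
  induction s using Multiset.induction_on with
  | empty =>
    intro t _ ht hst
    refine ⟨t, ht, hst.symm, fun ψ h => ⟨?_, le_rfl⟩⟩
    have hz : ∀ y ∈ t, y = 0 := fun y hy =>
      le_antisymm (by
        have := Multiset.single_le_sum ht y hy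
        rwa [← hst, Multiset.sum_zero] at this) (ht y hy)
    simp only [Multiset.map_zero, Multiset.sum_zero]
    refine Multiset.sum_nonneg fun r hr => ?_
    obtain ⟨y, hy, rfl⟩ := Multiset.mem_map.1 hr
    rw [hz y hy, h.1]
  | cons a s ih =>
    intro t hs ht hst
    have ha : 0 ≤ a := hs a (Multiset.mem_cons_self a s)
    have hs' : ∀ y ∈ s, 0 ≤ y := fun y hy => hs y (Multiset.mem_cons_of_mem hy)
    rw [Multiset.sum_cons] at hst
    obtain ⟨b, c, hb, hc, hbs, hcs, hψ⟩ := exists_split t a ht ha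
      (by rw [← hst]; exact le_add_of_nonneg_right (Multiset.sum_nonneg hs'))
    obtain ⟨r, hr, hrs, hrψ⟩ := ih c hs' hc (by rw [← hcs] at hst; exact add_left_cancel hst)
    refine ⟨b + r, ?_, by rw [Multiset.sum_add, hbs, hrs, Multiset.sum_cons], fun ψ h => ?_⟩
    · intro y hy
      rcases Multiset.mem_add.1 hy with hy | hy
      exacts [hb y hy, hr y hy]
    · have hab : ψ a ≤ (b.map ψ).sum := by
        rw [← hbs]
        exact h.le_sum_map b hb
      simp only [Multiset.map_cons, Multiset.sum_cons, Multiset.map_add, Multiset.sum_add]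
      constructor
      · linarith [(hrψ ψ h).1]
      · linarith [(hrψ ψ h).2, hψ ψ h]

/-- The finite positive families with sum `x`. -/
def Partition (x : X) : Type _ :=
  {s : Multiset X // (∀ y ∈ s, 0 ≤ y) ∧ s.sum = x}

/-- The sum of `ψ` over a partition. -/
def Partition.total {V : Type*} [AddCommMonoid V] {x : X} (π : Partition x) (ψ : X → V) : V :=
  (π.1.map ψ).sum

/-- `π` precedes `π'` if every subadditive function has a larger total on `π'`. In particular
a refinement of `π` comes after `π`. -/
instance (x : X) : Preorder (Partition x) where
  le π π' := ∀ ψ : X → ℝ, ConeSubadditive ψ → π.total ψ ≤ π'.total ψ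
  le_refl _ _ _ := le_rfl
  le_trans _ _ _ h h' ψ hψ := (h ψ hψ).trans (h' ψ hψ)

instance (x : X) : IsDirectedOrder (Partition x) where
  directed π π' := by
    obtain ⟨r, hr, hrs, h⟩ := exists_common_refinement π.1 π'.1 π.2.1 π'.2.1
      (π.2.2.trans π'.2.2.symm)
    exact ⟨⟨r, hr, hrs.trans π.2.2⟩, fun ψ hψ => (h ψ hψ).1, fun ψ hψ => (h ψ hψ).2⟩

/-- The partition with one member. -/
def Partition.single {x : X} (hx : 0 ≤ x) : Partition x :=
  ⟨{x}, by simpa using hx, by simp⟩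

theorem Partition.total_single {V : Type*} [AddCommMonoid V] {x : X} (hx : 0 ≤ x) (ψ : X → V) :
    (Partition.single hx).total ψ = ψ x := by
  simp [Partition.total, Partition.single]

theorem Partition.total_mono {x : X} (π : Partition x) {ψ ψ' : X → ℝ}
    (h : ∀ y, 0 ≤ y → ψ y ≤ ψ' y) : π.total ψ ≤ π.total ψ' :=
  Multiset.sum_map_le_sum_map _ _ fun y hy => h y (π.2.1 y hy)

theorem Partition.total_add {V : Type*} [AddCommMonoid V] {x : X} (π : Partition x)
    (ψ ψ' : X → V) : π.total (fun y => ψ y + ψ' y) = π.total ψ + π.total ψ' :=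
  Multiset.sum_map_add

theorem Partition.total_sub {V : Type*} [AddCommGroup V] {x : X} (π : Partition x)
    (ψ ψ' : X → V) : π.total (fun y => ψ y - ψ' y) = π.total ψ - π.total ψ' :=
  Multiset.sum_map_sub

theorem Partition.total_addMonoidHom {V : Type*} [AddCommMonoid V] {x : X} (π : Partition x)
    (f : X →+ V) : π.total f = f x := by
  rw [Partition.total, ← map_multiset_sum, π.2.2]

theorem Partition.norm_total_le {V : Type*} [SeminormedAddCommGroup V] {x : X} (π : Partition x)
    (ψ : X → V) : ‖π.total ψ‖ ≤ π.total (fun y => ‖ψ y‖) := by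
  refine (norm_multiset_sum_le _).trans (le_of_eq ?_)
  simp [Partition.total, Multiset.map_map]

end Partitions

/-! ### Functionals as limits over partitions, and order in the dual -/

section Dual

variable {X : Type*} [NormedAddCommGroup X] [Lattice X] [IsOrderedAddMonoid X] [HasSolidNorm X]
  [NormedSpace ℝ X]

/-- A positive additive function on the positive cone bounded by a multiple of the norm extends
to a bounded functional. -/
theorem exists_dual_of_additive (F : X → ℝ) (C : ℝ) (h0 : ∀ x, 0 ≤ x → 0 ≤ F x)
    (hC : ∀ x, 0 ≤ x → F x ≤ C * ‖x‖)
    (hadd : ∀ x y, 0 ≤ x → 0 ≤ y → F (x + y) = F x + F y) :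
    ∃ f : StrongDual ℝ X, ∀ x, 0 ≤ x → f x = F x := by
  have hz : F 0 = 0 := by have := hadd 0 0 le_rfl le_rfl; simpa using this
  have key : ∀ a b c d : X, 0 ≤ a → 0 ≤ b → 0 ≤ c → 0 ≤ d → a - b = c - d →
      F a - F b = F c - F d := by
    intro a b c d ha hb hc hd h
    have h1 : a + d = c + b := by rw [sub_eq_sub_iff_add_eq_add] at h; exact h
    have := hadd a d ha hd
    rw [h1, hadd c b hc hb] at this
    linarith
  -- Additivity on the cone makes `F a - F b` depend only on `a - b` (`key`), so the positive and
  -- negative parts give an additive extension.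
  let G : X →+ ℝ :=
    { toFun := fun x => F x⁺ - F x⁻
      map_zero' := by simp
      map_add' := fun x y => by
        have := key (x + y)⁺ (x + y)⁻ (x⁺ + y⁺) (x⁻ + y⁻) (posPart_nonneg _) (negPart_nonneg _)
          (add_nonneg (posPart_nonneg _) (posPart_nonneg _))
          (add_nonneg (negPart_nonneg _) (negPart_nonneg _)) (by
            rw [posPart_sub_negPart, add_sub_add_comm, posPart_sub_negPart, posPart_sub_negPart])
        rw [this, hadd _ _ (posPart_nonneg _) (posPart_nonneg _),
          hadd _ _ (negPart_nonneg _) (negPart_nonneg _)]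
        ring }
  have hG : ∀ x, ‖G x‖ ≤ C * ‖x‖ := by
    intro x
    have h1 : F x⁺ + F x⁻ = F |x| := by
      rw [← hadd _ _ (posPart_nonneg _) (negPart_nonneg _), posPart_add_negPart]
    have h2 := hC |x| (abs_nonneg x)
    rw [norm_abs_eq_norm] at h2
    have h3 := h0 x⁺ (posPart_nonneg _)
    have h4 := h0 x⁻ (negPart_nonneg _)
    change |F x⁺ - F x⁻| ≤ _
    rw [abs_le]; constructor <;> linarith
  refine ⟨G.toRealLinearMap (AddMonoidHomClass.continuous_of_bound G C hG), fun x hx => ?_⟩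
  change F x⁺ - F x⁻ = F x
  rw [posPart_of_nonneg hx, negPart_of_nonneg hx, hz, sub_zero]

/-- `f` is the limit of the totals of `ψ` along the partitions. -/
def IsPartitionLimit (ψ : X → ℝ) (f : StrongDual ℝ X) : Prop :=
  ∀ x, 0 ≤ x → Tendsto (fun π : Partition x => π.total ψ) atTop (𝓝 (f x))

theorem IsPartitionLimit.sub {ψ ψ' : X → ℝ} {f f' : StrongDual ℝ X} (h : IsPartitionLimit ψ f)
    (h' : IsPartitionLimit ψ' f') : IsPartitionLimit (fun y => ψ y - ψ' y) (f - f') := fun x hx => by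
  simp only [Partition.total_sub]
  exact (h x hx).sub (h' x hx)

theorem isPartitionLimit_self (f : StrongDual ℝ X) : IsPartitionLimit f f := fun x _ => by
  have : (fun π : Partition x => π.total f) = fun _ => f x :=
    funext fun π => π.total_addMonoidHom (f : X →+ ℝ)
  rw [this]; exact tendsto_const_nhds

instance Partition.atTop_neBot {x : X} [h : Fact (0 ≤ x)] :
    (atTop : Filter (Partition x)).NeBot :=
  have : Nonempty (Partition x) := ⟨Partition.single h.1⟩
  Filter.atTop_neBot

theorem IsPartitionLimit.le_of_le {ψ ψ' : X → ℝ} {f f' : StrongDual ℝ X}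
    (h : IsPartitionLimit ψ f) (h' : IsPartitionLimit ψ' f') (hle : ∀ y, 0 ≤ y → ψ y ≤ ψ' y)
    (x : X) (hx : 0 ≤ x) : f x ≤ f' x :=
  have : Fact (0 ≤ x) := ⟨hx⟩
  le_of_tendsto_of_tendsto' (h x hx) (h' x hx) fun π => π.total_mono hle

/-- The totals of a positive subadditive function with bounded totals converge. -/
theorem ConeSubadditive.exists_isPartitionLimit {ψ : X → ℝ} (hψ : ConeSubadditive ψ)
    (h0 : ∀ y, 0 ≤ y → 0 ≤ ψ y) (C : ℝ)
    (hC : ∀ x, 0 ≤ x → ∀ π : Partition x, π.total ψ ≤ C * ‖x‖) :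
    ∃ f : StrongDual ℝ X, IsPartitionLimit ψ f ∧ (∀ x, 0 ≤ x → ψ x ≤ f x) ∧
      ∀ x, 0 ≤ x → f x ≤ C * ‖x‖ := by
  have hb : ∀ x, 0 ≤ x → BddAbove (Set.range fun π : Partition x => π.total ψ) := by
    rintro x hx
    refine ⟨C * ‖x‖, ?_⟩
    rintro _ ⟨π, rfl⟩
    exact hC x hx π
  have hle : ∀ x, 0 ≤ x → ψ x ≤ ⨆ π : Partition x, π.total ψ := fun x hx => by
    have := le_ciSup (hb x hx) (Partition.single hx)
    simpa only [Partition.total_single] using this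
  have hub : ∀ x, 0 ≤ x → ⨆ π : Partition x, π.total ψ ≤ C * ‖x‖ := fun x hx => by
    have : Nonempty (Partition x) := ⟨Partition.single hx⟩
    exact ciSup_le (hC x hx)
  obtain ⟨f, hf⟩ := exists_dual_of_additive (fun x => ⨆ π : Partition x, π.total ψ) C
    (fun x hx => (h0 x hx).trans (hle x hx)) hub (by
      intro x y hx hy
      have : Nonempty (Partition x) := ⟨Partition.single hx⟩
      have : Nonempty (Partition y) := ⟨Partition.single hy⟩
      have : Nonempty (Partition (x + y)) := ⟨Partition.single (add_nonneg hx hy)⟩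
      -- Splitting a partition of `x + y` by Riesz decomposition gives one inequality; joining
      -- partitions of `x` and `y` gives the other.
      apply le_antisymm
      · refine ciSup_le fun π => ?_
        obtain ⟨b, c, hb', hc', hbs, hcs, h⟩ := exists_split π.1 x π.2.1 hx
          (by rw [π.2.2]; exact le_add_of_nonneg_right hy)
        rw [π.2.2] at hcs
        exact (h ψ hψ).trans (add_le_add
          (le_ciSup (hb x hx) (⟨b, hb', hbs⟩ : Partition x))
          (le_ciSup (hb y hy) (⟨c, hc', add_left_cancel hcs⟩ : Partition y)))
      · rw [← le_sub_iff_add_le]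
        refine ciSup_le fun π => ?_
        rw [le_sub_comm]
        refine ciSup_le fun π' => ?_
        rw [le_sub_iff_add_le, add_comm]
        have := le_ciSup (hb (x + y) (add_nonneg hx hy)) (⟨π.1 + π'.1, by
          intro z hz
          rcases Multiset.mem_add.1 hz with hz | hz
          exacts [π.2.1 z hz, π'.2.1 z hz], by
            rw [Multiset.sum_add, π.2.2, π'.2.2]⟩ : Partition (x + y))
        refine le_trans (le_of_eq ?_) this
        simp [Partition.total])
  refine ⟨f, fun x hx => ?_, fun x hx => by rw [hf x hx]; exact hle x hx,
    fun x hx => by rw [hf x hx]; exact hub x hx⟩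
  rw [hf x hx]
  exact tendsto_atTop_ciSup (fun π π' h => h ψ hψ) (hb x hx)

/-- Positivity gives `|f x| ≤ f |x|`, and `x` and `|x|` have the same norm. -/
theorem norm_le_of_mem_dualPosCone {f : StrongDual ℝ X} (hf : f ∈ dualPosCone X) {C : ℝ}
    (hC0 : 0 ≤ C) (hC : ∀ x, 0 ≤ x → f x ≤ C * ‖x‖) : ‖f‖ ≤ C := by
  refine f.opNorm_le_bound hC0 fun x => ?_
  have h1 := hf x⁺ (posPart_nonneg x)
  have h2 := hf x⁻ (negPart_nonneg x)
  have h3 : f x⁺ + f x⁻ = f |x| := by rw [← map_add, posPart_add_negPart]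
  have h4 : f x = f x⁺ - f x⁻ := by rw [← map_sub, posPart_sub_negPart]
  have h5 := hC |x| (abs_nonneg x)
  rw [norm_abs_eq_norm] at h5
  rw [Real.norm_eq_abs, abs_le]; constructor <;> linarith

/-- A functional bounded by `σ` on the positive unit ball is dominated by a positive functional
of norm at most `σ`. -/
theorem exists_pos_dominating (h : StrongDual ℝ X) {σ : ℝ} (hσ0 : 0 ≤ σ)
    (hσ : ∀ x, 0 ≤ x → h x ≤ σ * ‖x‖) :
    ∃ f ∈ dualPosCone X, (∀ x, 0 ≤ x → h x ≤ f x) ∧ ‖f‖ ≤ σ := by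
  -- The members on which `h` is nonnegative add up to `z`. Hence the totals of `max h 0` are values
  -- of `h` on the order interval `[0, x]`, and their limit is the positive part of `h`.
  have key : ∀ s : Multiset X, (∀ y ∈ s, 0 ≤ y) →
      ∃ z, 0 ≤ z ∧ z ≤ s.sum ∧ (s.map fun y => max (h y) 0).sum = h z := by
    intro s
    induction s using Multiset.induction_on with
    | empty => intro _; exact ⟨0, by simp⟩
    | cons a s ih =>
      intro hs
      obtain ⟨z, hz0, hz, hzs⟩ := ih fun y hy => hs y (Multiset.mem_cons_of_mem hy)
      have ha := hs a (Multiset.mem_cons_self a s)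
      simp only [Multiset.map_cons, Multiset.sum_cons, hzs]
      rcases le_total (h a) 0 with hle | hle
      · exact ⟨z, hz0, hz.trans (le_add_of_nonneg_left ha), by simp [hle]⟩
      · exact ⟨a + z, add_nonneg ha hz0, by gcongr, by simp [hle]⟩
  obtain ⟨f, -, hf1, hf2⟩ := ConeSubadditive.exists_isPartitionLimit
    (ψ := fun y => max (h y) 0) ⟨by simp, fun x y _ _ => by
      beta_reduce
      rw [map_add]
      exact max_le (add_le_add (le_max_left _ _) (le_max_left _ _))
        (add_nonneg (le_max_right _ _) (le_max_right _ _))⟩ (fun _ _ => le_max_right _ _) σ (by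
      intro x hx π
      obtain ⟨z, hz0, hz, hzs⟩ := key π.1 π.2.1
      rw [π.2.2] at hz
      change (π.1.map fun y => max (h y) 0).sum ≤ _
      rw [hzs]
      refine (hσ z hz0).trans (mul_le_mul_of_nonneg_left ?_ hσ0)
      exact norm_le_norm_of_abs_le_abs (by rwa [abs_of_nonneg hz0, abs_of_nonneg hx]))
  have hpos : f ∈ dualPosCone X := fun x hx => (le_max_right _ _).trans (hf1 x hx)
  exact ⟨f, hpos, fun x hx => (le_max_left _ _).trans (hf1 x hx),
    norm_le_of_mem_dualPosCone hpos hσ0 hf2⟩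

/-- Every functional is the difference of two positive functionals of at most its norm. -/
theorem exists_pos_sub_pos (h : StrongDual ℝ X) :
    ∃ f ∈ dualPosCone X, ∃ f' ∈ dualPosCone X, h = f - f' ∧ ‖f‖ ≤ ‖h‖ ∧ ‖f'‖ ≤ 2 * ‖h‖ := by
  obtain ⟨f, hf, hhf, hn⟩ := exists_pos_dominating h (norm_nonneg h)
    (fun x _ => (le_abs_self _).trans (h.le_opNorm x))
  refine ⟨f, hf, f - h, fun x hx => sub_nonneg.2 (hhf x hx), by abel, hn, ?_⟩
  linarith [norm_sub_le f h]

/-- A positive element of norm at most `r` of the bidual is in the weak* closure of the set of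
positive elements of norm at most `r`. -/
theorem exists_pos_approx [IsOrderedModule ℝ X] (ψ : StrongDual ℝ (StrongDual ℝ X)) {r : ℝ}
    (hr : 0 ≤ r) (hψ : ∀ f ∈ dualPosCone X, 0 ≤ ψ f) (hψr : ‖ψ‖ ≤ r) (h : StrongDual ℝ X) {η : ℝ}
    (hη : 0 < η) : ∃ z : X, 0 ≤ z ∧ ‖z‖ ≤ r ∧ ψ h - η < h z := by
  -- Otherwise `h ≤ ψ h - η` on the positive ball of radius `r`. A positive `f ≥ h` of norm at most
  -- `(ψ h - η) / r` then yields `ψ h ≤ ψ f ≤ ψ h - η`.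
  by_contra! hcon
  have h0 : ψ h - η ≥ 0 := by simpa using hcon 0 le_rfl (by simpa using hr)
  rcases hr.eq_or_lt with rfl | hr
  · have : ψ h ≤ 0 * ‖h‖ := (le_abs_self _).trans
      ((ψ.le_opNorm h).trans (mul_le_mul_of_nonneg_right hψr (norm_nonneg h)))
    linarith
  obtain ⟨f, hf, hhf, hn⟩ := exists_pos_dominating h (σ := (ψ h - η) / r)
    (div_nonneg h0 hr.le) (by
      intro x hx
      rcases eq_or_ne x 0 with rfl | hx0
      · simp
      have hxn : 0 < ‖x‖ := norm_pos_iff.2 hx0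
      have := hcon ((r / ‖x‖) • x) (smul_nonneg (by positivity) hx) (by
        rw [norm_smul, Real.norm_of_nonneg (by positivity)]; field_simp; exact le_rfl)
      rw [map_smul, smul_eq_mul] at this
      rw [div_mul_eq_mul_div, le_div_iff₀ hr]
      rw [div_mul_eq_mul_div, div_le_iff₀ hxn] at this
      linarith)
  have h1 : 0 ≤ ψ (f - h) := hψ _ fun x hx => sub_nonneg.2 (hhf x hx)
  rw [map_sub] at h1
  have h2 : ψ f ≤ r * ((ψ h - η) / r) :=
    (le_abs_self _).trans ((ψ.le_opNorm f).trans (mul_le_mul hψr hn (norm_nonneg _) hr.le))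
  rw [mul_div_cancel₀ _ hr.ne'] at h2
  linarith

end Dual

/-! ### Strong and weak sequence norms -/

section Norms

variable {E F : Type*} [NormedAddCommGroup E] [NormedSpace ℝ E] [NormedAddCommGroup F]
  [NormedSpace ℝ F]

theorem strongNorm_top (a : ℕ → E) : strongNorm ∞ a = ⨆ n, ‖a n‖ₑ := by simp [strongNorm]

theorem strongNorm_of_ne_top {p : ℝ≥0∞} (hp : p ≠ ∞) (a : ℕ → E) :
    strongNorm p a = (∑' n, ‖a n‖ₑ ^ p.toReal) ^ (1 / p.toReal) := by simp [strongNorm, hp]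

theorem toReal_pos_of_one_le {p : ℝ≥0∞} (hp : 1 ≤ p) (hp' : p ≠ ∞) : 0 < p.toReal :=
  ENNReal.toReal_pos (zero_lt_one.trans_le hp).ne' hp'

theorem strongNorm_le_mul {p : ℝ≥0∞} (hp : 1 ≤ p) {a : ℕ → E} {b : ℕ → F} (c : ℝ≥0∞)
    (h : ∀ n, ‖a n‖ₑ ≤ c * ‖b n‖ₑ) : strongNorm p a ≤ c * strongNorm p b := by
  by_cases hp' : p = ∞
  · subst hp'
    rw [strongNorm_top, strongNorm_top, ENNReal.mul_iSup]
    exact iSup_mono h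
  · have h0 := toReal_pos_of_one_le hp hp'
    rw [strongNorm_of_ne_top hp', strongNorm_of_ne_top hp']
    have : (c ^ p.toReal * ∑' n, ‖b n‖ₑ ^ p.toReal) ^ (1 / p.toReal) =
        c * (∑' n, ‖b n‖ₑ ^ p.toReal) ^ (1 / p.toReal) := by
      rw [ENNReal.mul_rpow_of_nonneg _ _ (by positivity), ← ENNReal.rpow_mul,
        mul_one_div_cancel h0.ne', ENNReal.rpow_one]
    rw [← this, ← ENNReal.tsum_mul_left]
    refine ENNReal.rpow_le_rpow (ENNReal.tsum_le_tsum fun n => ?_) (by positivity)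
    rw [← ENNReal.mul_rpow_of_nonneg _ _ h0.le]
    exact ENNReal.rpow_le_rpow (h n) h0.le

theorem strongNorm_mono {p : ℝ≥0∞} (hp : 1 ≤ p) {a : ℕ → E} {b : ℕ → F}
    (h : ∀ n, ‖a n‖ₑ ≤ ‖b n‖ₑ) : strongNorm p a ≤ strongNorm p b := by
  simpa using strongNorm_le_mul hp 1 (by simpa using h)

theorem strongNorm_comp_injective_le {p : ℝ≥0∞} (hp : 1 ≤ p) (a : ℕ → E) {i : ℕ → ℕ}
    (hi : Function.Injective i) : strongNorm p (fun n => a (i n)) ≤ strongNorm p a := by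
  by_cases hp' : p = ∞
  · subst hp'
    rw [strongNorm_top, strongNorm_top]
    exact iSup_comp_le (fun n => ‖a n‖ₑ) i
  · rw [strongNorm_of_ne_top hp', strongNorm_of_ne_top hp']
    exact ENNReal.rpow_le_rpow (ENNReal.tsum_comp_le_tsum_of_injective hi
      (fun n => ‖a n‖ₑ ^ p.toReal)) (by positivity)

/-- The sequence that alternates between `a` and `b`. -/
def interleave {α : Type*} (a b : ℕ → α) (n : ℕ) : α :=
  Sum.elim a b (Equiv.natSumNatEquivNat.symm n)

theorem comp_interleave {α β : Type*} (φ : α → β) (a b : ℕ → α) (n : ℕ) :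
    φ (interleave a b n) = interleave (fun n => φ (a n)) (fun n => φ (b n)) n := by
  unfold interleave
  cases Equiv.natSumNatEquivNat.symm n <;> rfl

theorem interleave_cases {α : Type*} {P : α → Prop} {a b : ℕ → α} (ha : ∀ n, P (a n))
    (hb : ∀ n, P (b n)) (n : ℕ) : P (interleave a b n) := by
  unfold interleave
  cases Equiv.natSumNatEquivNat.symm n
  exacts [ha _, hb _]

theorem hasSum_interleave {V : Type*} [AddCommMonoid V] [TopologicalSpace V] [ContinuousAdd V]
    {a b : ℕ → V} {x y : V} (ha : HasSum a x) (hb : HasSum b y) :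
    HasSum (interleave a b) (x + y) := by
  have : HasSum (Sum.elim a b) (x + y) := HasSum.sum (f := Sum.elim a b) ha hb
  exact (Equiv.natSumNatEquivNat.symm.hasSum_iff (f := Sum.elim a b)).2 this

/-- For finite `p` the `p`-th powers add, and `(s + t)^(1/p) ≤ s^(1/p) + t^(1/p)` because `1/p ≤ 1`.
The bound is crude but enough for small perturbations. -/
theorem strongNorm_interleave_le {p : ℝ≥0∞} (hp : 1 ≤ p) (a b : ℕ → E) :
    strongNorm p (interleave a b) ≤ strongNorm p a + strongNorm p b := by
  by_cases hp' : p = ∞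
  · subst hp'
    rw [strongNorm_top, strongNorm_top, strongNorm_top]
    refine iSup_le (interleave_cases (P := fun x => ‖x‖ₑ ≤ _) (fun n => ?_) fun n => ?_)
    · exact (le_iSup (fun n => ‖a n‖ₑ) n).trans le_self_add
    · exact (le_iSup (fun n => ‖b n‖ₑ) n).trans le_add_self
  · have h0 := toReal_pos_of_one_le hp hp'
    rw [strongNorm_of_ne_top hp', strongNorm_of_ne_top hp', strongNorm_of_ne_top hp']
    have h1 : ∑' n, ‖interleave a b n‖ₑ ^ p.toReal =
        ∑' n, ‖a n‖ₑ ^ p.toReal + ∑' n, ‖b n‖ₑ ^ p.toReal := by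
      refine HasSum.tsum_eq ?_
      have := hasSum_interleave (ENNReal.summable (f := fun n => ‖a n‖ₑ ^ p.toReal)).hasSum
        (ENNReal.summable (f := fun n => ‖b n‖ₑ ^ p.toReal)).hasSum
      rwa [← funext (comp_interleave (fun x : E => ‖x‖ₑ ^ p.toReal) a b)] at this
    rw [h1]
    exact ENNReal.rpow_add_le_add_rpow _ _ (by positivity) (by
      rw [div_le_one h0, ← ENNReal.toReal_one]
      exact ENNReal.toReal_mono hp' hp)

theorem strongNorm_single {p : ℝ≥0∞} (hp : 1 ≤ p) (x : E) :
    strongNorm p (Pi.single 0 x : ℕ → E) = ‖x‖ₑ := by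
  by_cases hp' : p = ∞
  · subst hp'
    rw [strongNorm_top]
    refine le_antisymm (iSup_le fun n => ?_) ?_
    · rcases eq_or_ne n 0 with rfl | hn
      · simp
      · simp [Pi.single_eq_of_ne hn]
    · simpa using le_iSup (fun n => ‖(Pi.single 0 x : ℕ → E) n‖ₑ) 0
  · have h0 := toReal_pos_of_one_le hp hp'
    rw [strongNorm_of_ne_top hp', tsum_eq_single 0 (fun n hn => by
      rw [Pi.single_eq_of_ne hn, enorm_zero, ENNReal.zero_rpow_of_pos h0]), Pi.single_eq_same,
      ← ENNReal.rpow_mul, mul_one_div_cancel h0.ne', ENNReal.rpow_one]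

theorem strongNorm_le_weakNorm (p : ℝ≥0∞) (a : ℕ → E) {φ : StrongDual ℝ E} (hφ : ‖φ‖ ≤ 1) :
    strongNorm p (fun n => φ (a n)) ≤ weakNorm p a :=
  le_iSup₂ (f := fun (φ : StrongDual ℝ E) (_ : ‖φ‖ ≤ 1) => strongNorm p fun n => φ (a n)) φ hφ

theorem weakNorm_le {p : ℝ≥0∞} {a : ℕ → E} {c : ℝ≥0∞}
    (h : ∀ φ : StrongDual ℝ E, ‖φ‖ ≤ 1 → strongNorm p (fun n => φ (a n)) ≤ c) :
    weakNorm p a ≤ c :=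
  iSup₂_le h

theorem strongNorm_apply_le {p : ℝ≥0∞} (hp : 1 ≤ p) (a : ℕ → E) (φ : StrongDual ℝ E) :
    strongNorm p (fun n => φ (a n)) ≤ ‖φ‖ₑ * weakNorm p a := by
  rcases eq_or_ne φ 0 with rfl | h
  · exact (strongNorm_le_mul hp (b := a) 0 (by simp)).trans (by simp)
  have hn : 0 < ‖φ‖ := norm_pos_iff.2 h
  have h1 := strongNorm_le_weakNorm p a (φ := ‖φ‖⁻¹ • φ) (by
    rw [norm_smul, norm_inv, norm_norm, inv_mul_cancel₀ hn.ne'])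
  refine (strongNorm_le_mul hp ‖φ‖ₑ fun n => ?_).trans (mul_le_mul_right h1 _)
  rw [smul_apply, ← enorm_norm φ, ← enorm_mul, smul_eq_mul,
    mul_inv_cancel_left₀ hn.ne']

theorem weakNorm_map_le {p : ℝ≥0∞} (hp : 1 ≤ p) (a : ℕ → E) (A : E →L[ℝ] F) :
    weakNorm p (fun n => A (a n)) ≤ ‖A‖ₑ * weakNorm p a := by
  refine weakNorm_le fun φ hφ => ?_
  refine (strongNorm_apply_le hp a (φ.comp A)).trans (mul_le_mul_left ?_ _)
  rw [← ofReal_norm, ← ofReal_norm]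
  refine ENNReal.ofReal_le_ofReal ((φ.opNorm_comp_le A).trans ?_)
  exact mul_le_of_le_one_left (norm_nonneg _) hφ

theorem weakNorm_comp_injective_le {p : ℝ≥0∞} (hp : 1 ≤ p) (a : ℕ → E) {i : ℕ → ℕ}
    (hi : Function.Injective i) : weakNorm p (fun n => a (i n)) ≤ weakNorm p a :=
  weakNorm_le fun φ hφ => (strongNorm_comp_injective_le hp (fun n => φ (a n)) hi).trans
    (strongNorm_le_weakNorm p a hφ)

theorem weakNorm_interleave_le {p : ℝ≥0∞} (hp : 1 ≤ p) (a b : ℕ → E) :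
    weakNorm p (interleave a b) ≤ weakNorm p a + weakNorm p b := by
  refine weakNorm_le fun φ hφ => ?_
  have : (fun n => φ (interleave a b n)) =
      interleave (fun n => φ (a n)) (fun n => φ (b n)) :=
    funext fun n => comp_interleave φ a b n
  rw [this]
  exact (strongNorm_interleave_le hp _ _).trans
    (add_le_add (strongNorm_le_weakNorm p a hφ) (strongNorm_le_weakNorm p b hφ))

theorem weakNorm_le_strongNorm {p : ℝ≥0∞} (hp : 1 ≤ p) (a : ℕ → E) :
    weakNorm p a ≤ strongNorm p a := by
  refine weakNorm_le fun φ hφ => strongNorm_mono hp fun n => ?_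
  rw [← ofReal_norm, ← ofReal_norm]
  exact ENNReal.ofReal_le_ofReal ((φ.le_opNorm _).trans (mul_le_of_le_one_left (norm_nonneg _) hφ))

theorem one_le_conjExponent (p : ℝ≥0∞) : 1 ≤ p.conjExponent := by
  simp [ENNReal.conjExponent]

end Norms

/-! ### Balanced representations and the ideal property -/

section Nuclear

variable {X Y E F : Type*} [NormedAddCommGroup X] [NormedSpace ℝ X] [LE X]
  [NormedAddCommGroup Y] [NormedSpace ℝ Y] [LE Y]
  [NormedAddCommGroup E] [NormedSpace ℝ E] [NormedAddCommGroup F] [NormedSpace ℝ F]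

/-- `T` has a positively `p`-nuclear representation both of whose norms are at most `r`. The
infimum of these `r` is the square root of the positively `p`-nuclear norm. -/
def HasBalancedRep (p : ℝ≥0∞) (T : X →L[ℝ] E) (r : ℝ≥0) : Prop :=
  ∃ (f : ℕ → StrongDual ℝ X) (a : ℕ → E), (∀ n, f n ∈ dualPosCone X) ∧
    weakNorm p.conjExponent f ≤ r ∧ strongNorm p a ≤ r ∧ ∀ x, HasSum (fun n => f n x • a n) (T x)

theorem HasBalancedRep.posNuclearNorm_le {p : ℝ≥0∞} {T : X →L[ℝ] E} {r : ℝ≥0}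
    (h : HasBalancedRep p T r) : posNuclearNorm p T ≤ (r : ℝ≥0∞) * r := by
  obtain ⟨f, a, h1, h2, h3, h4⟩ := h
  refine iInf_le_of_le f (iInf_le_of_le a (iInf_le_of_le
    ⟨h1, h2.trans_lt ENNReal.coe_lt_top, h3.trans_lt ENNReal.coe_lt_top, h4⟩ ?_))
  exact mul_le_mul' h2 h3

theorem IsPosNuclearRep.posNuclearNorm_le {p : ℝ≥0∞} {T : X →L[ℝ] E} {f : ℕ → StrongDual ℝ X}
    {a : ℕ → E} (h : IsPosNuclearRep p T f a) :
    posNuclearNorm p T ≤ weakNorm p.conjExponent f * strongNorm p a :=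
  iInf_le_of_le f (iInf_le_of_le a (iInf_le_of_le h le_rfl))

theorem dualPosCone_smul {f : StrongDual ℝ X} (hf : f ∈ dualPosCone X) {t : ℝ} (ht : 0 ≤ t) :
    t • f ∈ dualPosCone X := fun x hx => mul_nonneg ht (hf x hx)

/-- Scaling the functionals by `t` and the vectors by `t⁻¹` leaves the operator unchanged and moves
weight from one norm to the other. -/
theorem hasBalancedRep_of_weak_mul_strong_le {p : ℝ≥0∞} (hp : 1 ≤ p) {T : X →L[ℝ] E}
    {f : ℕ → StrongDual ℝ X} {a : ℕ → E} (h : IsPosNuclearRep p T f a) {r : ℝ≥0} (hr : 0 < r)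
    (hle : weakNorm p.conjExponent f * strongNorm p a ≤ (r : ℝ≥0∞) * r) :
    HasBalancedRep p T r := by
  obtain ⟨w, hw, -⟩ := ENNReal.lt_iff_exists_coe.1 h.weak_lt_top
  obtain ⟨s, hs, -⟩ := ENNReal.lt_iff_exists_coe.1 h.strong_lt_top
  rw [hw, hs] at hle
  norm_cast at hle
  -- `t = r / w` makes the weak norm exactly `r`; for `w = 0` any sufficiently large `t` serves.
  obtain ⟨t, ht, h1, h2⟩ : ∃ t : ℝ≥0, 0 < t ∧ t * w ≤ r ∧ t⁻¹ * s ≤ r := by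
    rcases eq_or_ne w 0 with rfl | hw0
    · refine ⟨s / r + 1, by positivity, by simp, ?_⟩
      rw [inv_mul_le_iff₀ (by positivity), add_mul, div_mul_cancel₀ _ hr.ne']
      exact le_self_add
    · have hw0 : 0 < w := pos_iff_ne_zero.2 hw0
      refine ⟨r / w, by positivity, by rw [div_mul_cancel₀ _ hw0.ne'], ?_⟩
      rw [inv_mul_le_iff₀ (by positivity), div_mul_eq_mul_div, le_div_iff₀ hw0, mul_comm]
      exact hle
  refine ⟨fun n => (t : ℝ) • f n, fun n => (t⁻¹ : ℝ) • a n,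
    fun n => dualPosCone_smul (h.pos n) t.2, ?_, ?_, fun x => ?_⟩
  · refine (weakNorm_map_le (one_le_conjExponent p) f
      ((t : ℝ) • ContinuousLinearMap.id ℝ (StrongDual ℝ X))).trans ?_
    rw [hw]
    refine le_trans (mul_le_mul_left (?_ : _ ≤ (t : ℝ≥0∞)) _) (by exact_mod_cast h1)
    rw [← ofReal_norm, ← ENNReal.ofReal_coe_nnreal]
    refine ENNReal.ofReal_le_ofReal (ContinuousLinearMap.opNorm_le_bound _ t.coe_nonneg fun g => ?_)
    change ‖(t : ℝ) • g‖ ≤ t * ‖g‖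
    rw [norm_smul, Real.norm_of_nonneg t.coe_nonneg]
  · refine (strongNorm_le_mul hp ((t⁻¹ : ℝ≥0) : ℝ≥0∞) (b := a) fun n => ?_).trans ?_
    · rw [enorm_smul, ← ofReal_norm, Real.norm_of_nonneg (by positivity), ← NNReal.coe_inv,
        ENNReal.ofReal_coe_nnreal]
    · rw [hs]; exact_mod_cast h2
  · have ht' : (t : ℝ) ≠ 0 := by positivity
    have := h.hasSum x
    convert this using 2 with n
    rw [smul_apply, smul_smul, smul_eq_mul, mul_right_comm, mul_inv_cancel₀ ht', one_mul]

theorem hasBalancedRep_of_posNuclearNorm_lt {p : ℝ≥0∞} (hp : 1 ≤ p) {T : X →L[ℝ] E} {r : ℝ≥0}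
    (h : posNuclearNorm p T < (r : ℝ≥0∞) * r) : HasBalancedRep p T r := by
  simp only [posNuclearNorm, iInf_lt_iff] at h
  obtain ⟨f, a, hfa, hlt⟩ := h
  refine hasBalancedRep_of_weak_mul_strong_le hp hfa (pos_iff_ne_zero.2 ?_) hlt.le
  rintro rfl
  simp at hlt

/-- Interleaving adds both norms at worst, so the radii add. Bounding the two factors by the same
number is what avoids cross terms in their product. -/
theorem HasBalancedRep.add {p : ℝ≥0∞} (hp : 1 ≤ p) {T T' : X →L[ℝ] E} {r r' : ℝ≥0}
    (h : HasBalancedRep p T r) (h' : HasBalancedRep p T' r') :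
    HasBalancedRep p (T + T') (r + r') := by
  obtain ⟨f, a, h1, h2, h3, h4⟩ := h
  obtain ⟨f', a', h1', h2', h3', h4'⟩ := h'
  refine ⟨interleave f f', interleave a a', interleave_cases h1 h1',
    (weakNorm_interleave_le (one_le_conjExponent p) f f').trans ?_,
    (strongNorm_interleave_le hp a a').trans ?_, fun x => ?_⟩
  · push_cast; exact add_le_add h2 h2'
  · push_cast; exact add_le_add h3 h3'
  · have := hasSum_interleave (h4 x) (h4' x)
    rw [add_apply]
    convert this using 2 with n
    unfold interleave
    cases Equiv.natSumNatEquivNat.symm n <;> rfl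

theorem hasBalancedRep_zero {p : ℝ≥0∞} (hp : 1 ≤ p) :
    HasBalancedRep p (0 : X →L[ℝ] E) 0 := by
  have h1 : strongNorm p (fun _ : ℕ => (0 : E)) ≤ 0 := by
    simpa using strongNorm_le_mul (a := fun _ : ℕ => (0 : E)) (b := fun _ : ℕ => (0 : E)) hp 0
      (by simp)
  have h2 : strongNorm p.conjExponent (fun _ : ℕ => (0 : StrongDual ℝ X)) ≤ 0 := by
    simpa using strongNorm_le_mul (a := fun _ : ℕ => (0 : StrongDual ℝ X))
      (b := fun _ : ℕ => (0 : E)) (one_le_conjExponent p) 0 (by simp)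
  exact ⟨fun _ => 0, fun _ => 0, fun _ x _ => le_rfl, by
    simpa using (weakNorm_le_strongNorm (one_le_conjExponent p) _).trans h2, by simpa using h1,
    fun x => by simp⟩

theorem HasBalancedRep.sum {p : ℝ≥0∞} (hp : 1 ≤ p) {ι : Type*} (s : Finset ι)
    {T : ι → X →L[ℝ] E} {r : ι → ℝ≥0} (h : ∀ i ∈ s, HasBalancedRep p (T i) (r i)) :
    HasBalancedRep p (∑ i ∈ s, T i) (∑ i ∈ s, r i) := by
  classical
  induction s using Finset.induction_on with
  | empty => simpa using hasBalancedRep_zero hp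
  | insert i s hi ih =>
    rw [Finset.sum_insert hi, Finset.sum_insert hi]
    exact (h i (Finset.mem_insert_self i s)).add hp
      (ih fun j hj => h j (Finset.mem_insert_of_mem hj))

theorem HasBalancedRep.neg {p : ℝ≥0∞} (hp : 1 ≤ p) {T : X →L[ℝ] E} {r : ℝ≥0}
    (h : HasBalancedRep p T r) : HasBalancedRep p (-T) r := by
  obtain ⟨f, a, h1, h2, h3, h4⟩ := h
  refine ⟨f, fun n => -a n, h1, h2, (strongNorm_mono hp fun n => by simp).trans h3, fun x => ?_⟩
  simpa using (h4 x).neg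

theorem HasBalancedRep.mono {p : ℝ≥0∞} {T : X →L[ℝ] E} {r r' : ℝ≥0}
    (h : HasBalancedRep p T r) (hr : r ≤ r') : HasBalancedRep p T r' := by
  obtain ⟨f, a, h1, h2, h3, h4⟩ := h
  exact ⟨f, a, h1, h2.trans (by exact_mod_cast hr), h3.trans (by exact_mod_cast hr), h4⟩

/-- The ideal property. -/
theorem IsPosNuclearRep.comp {p : ℝ≥0∞} (hp : 1 ≤ p) {T : X →L[ℝ] E} {f : ℕ → StrongDual ℝ X}
    {a : ℕ → E} (h : IsPosNuclearRep p T f a) {S : Y →L[ℝ] X}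
    (hS : ∀ y ∈ posCone Y, S y ∈ posCone X) (R : E →L[ℝ] F) :
    IsPosNuclearRep p (R.comp (T.comp S)) (fun n => (f n).comp S) (fun n => R (a n)) ∧
      weakNorm p.conjExponent (fun n => (f n).comp S) ≤ ‖S‖ₑ * weakNorm p.conjExponent f ∧
      strongNorm p (fun n => R (a n)) ≤ ‖R‖ₑ * strongNorm p a := by
  have h1 : weakNorm p.conjExponent (fun n => (f n).comp S) ≤
      ‖S‖ₑ * weakNorm p.conjExponent f := by
    refine (weakNorm_map_le (one_le_conjExponent p) f
      ((ContinuousLinearMap.compL ℝ Y X ℝ).flip S)).trans (mul_le_mul_left ?_ _)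
    rw [← ofReal_norm, ← ofReal_norm]
    refine ENNReal.ofReal_le_ofReal (ContinuousLinearMap.opNorm_le_bound _ (norm_nonneg _) ?_)
    intro g
    rw [mul_comm]
    exact g.opNorm_comp_le S
  have h2 : strongNorm p (fun n => R (a n)) ≤ ‖R‖ₑ * strongNorm p a :=
    strongNorm_le_mul hp _ fun n => R.le_opENorm (a n)
  refine ⟨⟨fun n y hy => h.pos n _ (hS y hy), h1.trans_lt ?_, h2.trans_lt ?_, fun y => ?_⟩, h1, h2⟩
  · exact ENNReal.mul_lt_top enorm_lt_top h.weak_lt_top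
  · exact ENNReal.mul_lt_top enorm_lt_top h.strong_lt_top
  · simpa using (h.hasSum (S y)).mapL R

theorem posNuclearNorm_comp_le {p : ℝ≥0∞} (hp : 1 ≤ p) {T : X →L[ℝ] E}
    {f : ℕ → StrongDual ℝ X} {a : ℕ → E} (h : IsPosNuclearRep p T f a) {S : Y →L[ℝ] X}
    (hS : ∀ y ∈ posCone Y, S y ∈ posCone X) (R : E →L[ℝ] F) :
    posNuclearNorm p (R.comp (T.comp S)) ≤
      ‖R‖ₑ * ‖S‖ₑ * (weakNorm p.conjExponent f * strongNorm p a) := by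
  obtain ⟨h0, h1, h2⟩ := h.comp hp hS R
  refine h0.posNuclearNorm_le.trans ((mul_le_mul' h1 h2).trans (le_of_eq ?_))
  ring

end Nuclear

/-! ### Nuclear norms of rank one operators -/

section RankOne

variable {X E : Type*} [NormedAddCommGroup X] [Lattice X] [IsOrderedAddMonoid X] [HasSolidNorm X]
  [NormedSpace ℝ X] [NormedAddCommGroup E] [NormedSpace ℝ E]

theorem hasBalancedRep_smulRight_of_pos {p : ℝ≥0∞} (hp : 1 ≤ p) {f : StrongDual ℝ X}
    (hf : f ∈ dualPosCone X) (u : E) {r : ℝ≥0} (hr : 0 < r) (hle : ‖f‖ * ‖u‖ ≤ r * r) :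
    HasBalancedRep p (f.smulRight u) r := by
  have hw : weakNorm p.conjExponent (Pi.single 0 f : ℕ → StrongDual ℝ X) ≤ ‖f‖ₑ :=
    (weakNorm_le_strongNorm (one_le_conjExponent p) _).trans
      (strongNorm_single (one_le_conjExponent p) f).le
  have hs := strongNorm_single hp u
  refine hasBalancedRep_of_weak_mul_strong_le hp (f := Pi.single 0 f) (a := Pi.single 0 u)
    ⟨fun n => ?_, hw.trans_lt enorm_lt_top, hs.trans_lt enorm_lt_top, fun x => ?_⟩ hr ?_
  · rcases eq_or_ne n 0 with rfl | hn
    · simpa using hf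
    · rw [Pi.single_eq_of_ne hn]; exact fun x _ => le_rfl
  · have := hasSum_single (f := fun n => (Pi.single 0 f : ℕ → StrongDual ℝ X) n x •
      (Pi.single 0 u : ℕ → E) n) 0 (fun n hn => by simp [Pi.single_eq_of_ne hn])
    simpa using this
  · rw [hs]
    refine (mul_le_mul_left hw _).trans ?_
    rw [← ofReal_norm, ← ofReal_norm, ← ENNReal.ofReal_mul (norm_nonneg _),
      ← ENNReal.ofReal_coe_nnreal, ← ENNReal.ofReal_mul r.coe_nonneg]
    exact ENNReal.ofReal_le_ofReal hle

/-- Splitting `f` into positive functionals of norms at most `‖f‖` and `2 ‖f‖` accounts for the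
factor `2` and for the two radii `r`. -/
theorem hasBalancedRep_smulRight {p : ℝ≥0∞} (hp : 1 ≤ p) (f : StrongDual ℝ X) (u : E) {r : ℝ≥0}
    (hr : 0 < r) (hle : 2 * (‖f‖ * ‖u‖) ≤ r * r) : HasBalancedRep p (f.smulRight u) (r + r) := by
  obtain ⟨g, hg, g', hg', rfl, hn, hn'⟩ := exists_pos_sub_pos f
  have h0 := mul_nonneg (norm_nonneg (g - g')) (norm_nonneg u)
  have h1 := hasBalancedRep_smulRight_of_pos hp hg u hr (by
    have := mul_le_mul_of_nonneg_right hn (norm_nonneg u); linarith)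
  have h2 := hasBalancedRep_smulRight_of_pos hp hg' u hr (by
    have := mul_le_mul_of_nonneg_right hn' (norm_nonneg u); linarith)
  have := h1.add hp (h2.neg hp)
  convert this using 1
  ext x
  simp [sub_smul, ← sub_eq_add_neg]

end RankOne

/-! ### Positive local reflexivity -/

section LocalReflexivity

variable {X : Type*} [NormedAddCommGroup X] [Lattice X] [IsOrderedAddMonoid X] [HasSolidNorm X]
  [NormedSpace ℝ X] [IsOrderedModule ℝ X]

/-- A positive finite rank operator on the dual is a finite sum of rank one operators with
positive vectors (but in general without positive functionals). -/
theorem exists_rankOne_decomposition {Q : StrongDual ℝ X →L[ℝ] StrongDual ℝ X}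
    (hQ : FiniteRank Q) (hpos : ∀ f ∈ dualPosCone X, Q f ∈ dualPosCone X) :
    ∃ (κ : Type) (_ : Fintype κ) (g : κ → StrongDual ℝ X)
      (φ : κ → StrongDual ℝ (StrongDual ℝ X)), (∀ j, g j ∈ dualPosCone X) ∧
      ∀ h, Q h = ∑ j, φ j h • g j := by
  -- Since positive functionals span the dual, their images span the range of `Q`. A basis chosen
  -- among these images consists of positive functionals.
  let s : Set (StrongDual ℝ X) := Q '' dualPosCone X
  obtain ⟨b, hbs, hspan, hli⟩ := exists_linearIndependent ℝ s
  let W := Submodule.span ℝ (Set.range ((↑) : b → StrongDual ℝ X))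
  have hW : W = Submodule.span ℝ b := by simp [W]
  have hmem : ∀ h, Q h ∈ W := by
    intro h
    rw [hW, hspan]
    obtain ⟨f, hf, f', hf', rfl, -, -⟩ := exists_pos_sub_pos h
    rw [map_sub]
    exact Submodule.sub_mem _ (Submodule.subset_span ⟨f, hf, rfl⟩)
      (Submodule.subset_span ⟨f', hf', rfl⟩)
  have hle : W ≤ LinearMap.range (Q : StrongDual ℝ X →ₗ[ℝ] StrongDual ℝ X) := by
    rw [hW, Submodule.span_le]
    intro x hx
    obtain ⟨f, -, rfl⟩ := hbs hx
    exact ⟨f, rfl⟩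
  have hfd : FiniteDimensional ℝ (LinearMap.range (Q : StrongDual ℝ X →ₗ[ℝ] StrongDual ℝ X)) := hQ
  have hfd' : FiniteDimensional ℝ W := Submodule.finiteDimensional_of_le hle
  let B : Module.Basis b ℝ W := Module.Basis.span hli
  have hfin : Finite b := B.linearIndependent.finite
  obtain ⟨n, ⟨σ⟩⟩ := Finite.exists_equiv_fin b
  let B' := B.reindex σ
  have hC : ∀ j, Continuous (B'.coord j : W → ℝ) := fun j =>
    LinearMap.continuous_of_finiteDimensional (E := W) (B'.coord j : W →ₗ[ℝ] ℝ)
  let C : Fin n → W →L[ℝ] ℝ := fun j =>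
    ⟨B'.coord j, hC j⟩
  refine ⟨Fin n, inferInstance, fun j => (σ.symm j : StrongDual ℝ X), fun j =>
    (C j).comp (Q.codRestrict W hmem), ?_, ?_⟩
  · intro j
    obtain ⟨f, hf, hfx⟩ := hbs (σ.symm j).2
    change ((σ.symm j : b) : StrongDual ℝ X) ∈ _
    rw [← hfx]
    exact hpos f hf
  · intro h
    have := congrArg Subtype.val (B'.sum_repr ⟨Q h, hmem h⟩)
    simp only [Submodule.coe_sum, Submodule.coe_smul] at this
    refine this.symm.trans (Finset.sum_congr rfl fun j _ => ?_)
    have hB : ((B' j : W) : StrongDual ℝ X) = σ.symm j := by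
      rw [Module.Basis.reindex_apply]
      exact congrArg Subtype.val (Module.Basis.span_apply hli _)
    rw [hB]
    rfl

/-- This is Goldstine's theorem tested on one functional: otherwise `‖h‖ ≤ (φ h - η) / ‖φ‖`, which
contradicts `φ h ≤ ‖φ‖ ‖h‖`. Together with its positive analogue it handles each term of a
separating functional. -/
theorem exists_norm_le_approx (φ : StrongDual ℝ (StrongDual ℝ X)) (h : StrongDual ℝ X) {η : ℝ}
    (hη : 0 < η) : ∃ y : X, ‖y‖ ≤ ‖φ‖ ∧ φ h - η < h y := by
  by_contra! hcon
  have h0 : 0 ≤ φ h - η := by simpa using hcon 0 (by rw [norm_zero]; exact norm_nonneg φ)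
  rcases (norm_nonneg φ).eq_or_lt with hr | hr
  · have : φ h ≤ ‖φ‖ * ‖h‖ := (le_abs_self _).trans (φ.le_opNorm h)
    rw [← hr] at this; linarith
  have hn : ‖h‖ ≤ (φ h - η) / ‖φ‖ := by
    have key : ∀ x, h x ≤ (φ h - η) / ‖φ‖ * ‖x‖ := by
      intro x
      rcases eq_or_ne x 0 with rfl | hx0
      · simp
      have hxn : 0 < ‖x‖ := norm_pos_iff.2 hx0
      have := hcon ((‖φ‖ / ‖x‖) • x) (by
        rw [norm_smul, Real.norm_of_nonneg (by positivity)]; field_simp; exact le_rfl)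
      rw [map_smul, smul_eq_mul, div_mul_eq_mul_div, div_le_iff₀ hxn] at this
      rw [div_mul_eq_mul_div, le_div_iff₀ hr]
      linarith
    refine h.opNorm_le_bound (div_nonneg h0 hr.le) fun x => ?_
    rw [Real.norm_eq_abs, abs_le']
    refine ⟨key x, ?_⟩
    have := key (-x)
    rwa [map_neg, norm_neg] at this
  have : φ h ≤ ‖φ‖ * ((φ h - η) / ‖φ‖) :=
    (le_abs_self _).trans ((φ.le_opNorm h).trans (mul_le_mul_of_nonneg_left hn hr.le))
  rw [mul_div_cancel₀ _ hr.ne'] at this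
  linarith

/-- A finite system of linear and order conditions solvable in the bidual is approximately
solvable in the space. -/
theorem exists_approx_solution {ι κ ν : Type*} [Fintype ι] [Fintype κ] [Fintype ν]
    (c : ι → κ → ℝ) (φ : κ → StrongDual ℝ (StrongDual ℝ X)) (r : ι → ℝ) (hr : ∀ i, 0 ≤ r i)
    (hpos : ∀ i, ∀ h ∈ dualPosCone X, 0 ≤ ∑ j, c i j * φ j h)
    (hbd : ∀ i h, |∑ j, c i j * φ j h| ≤ r i * ‖h‖) (f : ν → StrongDual ℝ X) {η : ℝ}
    (hη : 0 < η) :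
    ∃ (y : κ → X) (z : ι → X), (∀ j, ‖y j‖ ≤ ‖φ j‖) ∧ (∀ i, 0 ≤ z i ∧ ‖z i‖ ≤ r i) ∧
      (∀ i, ‖∑ j, c i j • y j - z i‖ < η) ∧ ∀ n j, |f n (y j) - φ j (f n)| < η := by
  classical
  -- The bidual solution `y j = φ j`, `z i = ∑ j, c i j • φ j` corresponds to the target `w₀`. The
  -- task is to approach `w₀` by values of `L` on the convex set `A` of admissible points of `X`.
  let L : (κ → X) × (ι → X) →ₗ[ℝ] (ι → X) × (ν → κ → ℝ) :=
    { toFun := fun p => (fun i => ∑ j, c i j • p.1 j - p.2 i, fun n j => f n (p.1 j))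
      map_add' := fun p q => by
        ext
        · simp [Finset.sum_add_distrib, smul_add]; abel
        · simp
      map_smul' := fun t p => by
        ext
        · simp [Finset.smul_sum, smul_sub, smul_comm t]
        · simp }
  let A : Set ((κ → X) × (ι → X)) :=
    {p | (∀ j, ‖p.1 j‖ ≤ ‖φ j‖) ∧ ∀ i, 0 ≤ p.2 i ∧ ‖p.2 i‖ ≤ r i}
  have hA : Convex ℝ A := by
    rintro p ⟨hp1, hp2⟩ q ⟨hq1, hq2⟩ a b ha hb hab
    have hnorm : ∀ (u v : X) (M : ℝ), ‖u‖ ≤ M → ‖v‖ ≤ M → ‖a • u + b • v‖ ≤ M := by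
      intro u v M hu hv
      refine (norm_add_le _ _).trans ?_
      rw [norm_smul, norm_smul, Real.norm_of_nonneg ha, Real.norm_of_nonneg hb]
      calc a * ‖u‖ + b * ‖v‖ ≤ a * M + b * M := by gcongr
        _ = M := by rw [← add_mul, hab, one_mul]
    exact ⟨fun j => hnorm _ _ _ (hp1 j) (hq1 j), fun i =>
      ⟨add_nonneg (smul_nonneg ha (hp2 i).1) (smul_nonneg hb (hq2 i).1),
        hnorm _ _ _ (hp2 i).2 (hq2 i).2⟩⟩
  let w₀ : (ι → X) × (ν → κ → ℝ) := (0, fun n j => φ j (f n))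
  have hmem : w₀ ∈ closure (L '' A) := by
    by_contra hw
    obtain ⟨Λ, s, hs, hs'⟩ := geometric_hahn_banach_closed_point
      (hA.linear_image L).closure isClosed_closure hw
    let h : ι → StrongDual ℝ X := fun i =>
      (Λ.comp (ContinuousLinearMap.inl ℝ (ι → X) (ν → κ → ℝ))).comp
        (ContinuousLinearMap.single ℝ (fun _ : ι => X) i)
    let b : ν → κ → ℝ := fun n j => Λ (0, Pi.single n (Pi.single j 1))
    have hΛ : ∀ (v : ι → X) (t : ν → κ → ℝ),
        Λ (v, t) = ∑ i, h i (v i) + ∑ n, ∑ j, b n j * t n j := by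
      intro v t
      have h1 : v = ∑ i, Pi.single i (v i) := (Finset.univ_sum_single v).symm
      have h2 : t = ∑ n, ∑ j, t n j • Pi.single n (Pi.single j (1 : ℝ)) := by
        ext n j
        simp [Finset.sum_apply, Pi.single_apply, ite_apply]
      have h3 : Λ (v, t) = Λ (v, 0) + Λ (0, t) := by rw [← map_add]; simp
      have h4 : Λ (v, 0) = ∑ i, h i (v i) := by
        have : Λ (v, 0) = (Λ.comp (ContinuousLinearMap.inl ℝ (ι → X) (ν → κ → ℝ))) v := rfl
        rw [this]
        conv_lhs => rw [h1]
        rw [map_sum]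
        rfl
      have h5 : Λ (0, t) = ∑ n, ∑ j, b n j * t n j := by
        have : Λ (0, t) = (Λ.comp (ContinuousLinearMap.inr ℝ (ι → X) (ν → κ → ℝ))) t := rfl
        rw [this]
        conv_lhs => rw [h2]
        simp only [map_sum, map_smul, smul_eq_mul]
        refine Finset.sum_congr rfl fun n _ => Finset.sum_congr rfl fun j _ => mul_comm _ _
      rw [h3, h4, h5]
    -- Collecting coefficients turns the separating functional composed with `L` into independent
    -- functionals of the `y j` and `z i`; `Λ w₀` is the same expression at the bidual solution.
    let l : κ → StrongDual ℝ X := fun j => ∑ i, c i j • h i + ∑ n, b n j • f n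
    have hL : ∀ p, Λ (L p) = ∑ j, l j (p.1 j) - ∑ i, h i (p.2 i) := by
      intro p
      change Λ (fun i => ∑ j, c i j • p.1 j - p.2 i, fun n j => f n (p.1 j)) = _
      rw [hΛ]
      simp only [l, map_sub, map_sum, map_smul, Finset.sum_sub_distrib, add_apply,
        sum_apply, smul_apply, Finset.sum_add_distrib]
      rw [Finset.sum_comm, Finset.sum_comm (f := fun n j => b n j * f n (p.1 j))]
      simp only [smul_eq_mul]
      ring
    have hw₀ : Λ w₀ = ∑ j, φ j (l j) - ∑ i, ∑ j, c i j * φ j (h i) := by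
      change Λ (0, fun n j => φ j (f n)) = _
      rw [hΛ]
      simp only [l, map_add, map_sum, map_smul, Pi.zero_apply, map_zero, Finset.sum_const_zero,
        Finset.sum_add_distrib, smul_eq_mul]
      rw [Finset.sum_comm, Finset.sum_comm (f := fun i j => c i j * φ j (h i))]
      ring
    -- The separation gap is shared among all the variables, with one share left over for the strict
    -- contradiction.
    let η' : ℝ := (Λ w₀ - s) / (Fintype.card κ + Fintype.card ι + 1)
    have hη' : 0 < η' := div_pos (sub_pos.2 hs') (by positivity)
    choose y hy1 hy2 using fun j => exists_norm_le_approx (φ j) (l j) hη'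
    have hz : ∀ i, ∃ z : X, 0 ≤ z ∧ ‖z‖ ≤ r i ∧ (∑ j, c i j • φ j) (-h i) - η' < (-h i) z := by
      intro i
      refine exists_pos_approx _ (hr i) (fun h' hh' => ?_) ?_ _ hη'
      · simpa [sum_apply] using hpos i h' hh'
      · refine ContinuousLinearMap.opNorm_le_bound _ (hr i) fun h' => ?_
        simpa [sum_apply] using hbd i h'
    choose z hz0 hz1 hz2 using hz
    have h1 := hs (L (y, z)) (subset_closure ⟨(y, z), ⟨hy1, fun i => ⟨hz0 i, hz1 i⟩⟩, rfl⟩)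
    rw [hL] at h1
    have h2 : ∑ j, φ j (l j) - Fintype.card κ * η' ≤ ∑ j, l j (y j) := by
      have := Finset.sum_le_sum fun j (_ : j ∈ Finset.univ) => (hy2 j).le
      simpa [Finset.sum_sub_distrib] using this
    have h3 : ∑ i, h i (z i) ≤ ∑ i, ∑ j, c i j * φ j (h i) + Fintype.card ι * η' := by
      have := Finset.sum_le_sum fun i (_ : i ∈ Finset.univ) => (hz2 i).le
      simp [Finset.sum_sub_distrib] at this
      linarith
    have h4 : η' * (Fintype.card κ + Fintype.card ι + 1) = Λ w₀ - s :=
      div_mul_cancel₀ _ (by positivity)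
    simp only at h1
    linarith
  obtain ⟨_, ⟨⟨y, z⟩, ⟨hy, hz⟩, rfl⟩, hdist⟩ := Metric.mem_closure_iff.1 hmem η hη
  rw [dist_comm, dist_eq_norm] at hdist
  have h1 : ‖(L (y, z) - w₀).1‖ < η := (norm_fst_le _).trans_lt hdist
  have h2 : ‖(L (y, z) - w₀).2‖ < η := (norm_snd_le _).trans_lt hdist
  refine ⟨y, z, hy, hz, fun i => ?_, fun n j => ?_⟩
  · have := (norm_le_pi_norm (L (y, z) - w₀).1 i).trans_lt h1
    simpa [L, w₀] using this
  · have := (norm_le_pi_norm _ j).trans_lt ((norm_le_pi_norm (L (y, z) - w₀).2 n).trans_lt h2)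
    simpa [L, w₀] using this

end LocalReflexivity

/-! ### Positive finite rank operators on the predual -/

theorem exists_finite_net {X κ : Type*} [Fintype κ] (A : Set X) (t : X → κ → ℝ)
    {M : ℝ} (hM : ∀ x ∈ A, ∀ j, |t x j| ≤ M) {δ : ℝ} (hδ : 0 < δ) :
    ∃ s : Set X, s ⊆ A ∧ s.Finite ∧ ∀ x ∈ A, ∃ x' ∈ s, ∀ j, |t x j - t x' j| ≤ δ := by
  have hb : TotallyBounded (t '' A) := by
    refine (isCompact_closedBall (0 : κ → ℝ) (max M 0)).totallyBounded.subset ?_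
    rintro _ ⟨x, hx, rfl⟩
    rw [mem_closedBall_zero_iff, pi_norm_le_iff_of_nonneg (le_max_right _ _)]
    exact fun j => (hM x hx j).trans (le_max_left _ _)
  obtain ⟨u, hu, hfin, hcov⟩ := Metric.finite_approx_of_totallyBounded hb δ hδ
  obtain ⟨s, hs, hsfin, rfl⟩ := Set.exists_subset_image_finite_and.1 ⟨u, hu, hfin, rfl⟩
  refine ⟨s, hs, hsfin, fun x hx => ?_⟩
  obtain ⟨v, hv, hxv⟩ := Set.mem_iUnion₂.1 (hcov ⟨x, hx, rfl⟩)
  obtain ⟨x', hx', rfl⟩ := hv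
  refine ⟨x', hx', fun j => ?_⟩
  have := (dist_le_pi_dist (t x) (t x') j).trans (Metric.mem_ball.1 hxv).le
  rwa [Real.dist_eq] at this

theorem finiteRank_of_forall_mem_span {V W : Type*} [NormedAddCommGroup V] [NormedSpace ℝ V]
    [NormedAddCommGroup W] [NormedSpace ℝ W] {T : V →L[ℝ] W} {s : Set W} (hs : s.Finite)
    (h : ∀ x, T x ∈ Submodule.span ℝ s) : FiniteRank T := by
  have : FiniteDimensional ℝ (Submodule.span ℝ s) := FiniteDimensional.span_of_finite ℝ hs
  refine Submodule.finiteDimensional_of_le (S₂ := Submodule.span ℝ s) ?_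
  rintro _ ⟨x, rfl⟩
  exact h x

section PositiveApproximation

variable {X : Type*} [NormedAddCommGroup X] [Lattice X] [IsOrderedAddMonoid X] [HasSolidNorm X]
  [NormedSpace ℝ X] [IsOrderedModule ℝ X]

theorem norm_le_norm_of_nonneg_of_le {x y : X} (hx : 0 ≤ x) (h : x ≤ y) : ‖x‖ ≤ ‖y‖ :=
  norm_le_norm_of_abs_le_abs (by rwa [abs_of_nonneg hx, abs_of_nonneg (hx.trans h)])

theorem abs_smul_le (c : ℝ) (y : X) : |c • y| ≤ |c| • |y| := by
  have key : ∀ c : ℝ, 0 ≤ c → ∀ y : X, |c • y| ≤ c • |y| := fun c hc y =>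
    abs_le'.2 ⟨smul_le_smul_of_nonneg_left (le_abs_self y) hc, by
      rw [← smul_neg]; exact smul_le_smul_of_nonneg_left (neg_le_abs y) hc⟩
  rcases le_total 0 c with hc | hc
  · rw [abs_of_nonneg hc]; exact key c hc y
  · have := key (-c) (neg_nonneg.2 hc) y
    rwa [neg_smul, abs_neg, ← abs_of_nonpos hc] at this

theorem abs_map_le {S : X →L[ℝ] X} (hS : ∀ x ∈ posCone X, S x ∈ posCone X) (x : X) :
    |S x| ≤ S |x| := by
  have h1 : 0 ≤ S (|x| - x) := hS _ (sub_nonneg.2 (le_abs_self x))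
  have h2 : 0 ≤ S (|x| + x) := hS _ (by
    have := sub_nonneg.2 (neg_le_abs x); rwa [sub_neg_eq_add] at this)
  rw [map_sub, sub_nonneg] at h1
  rw [map_add] at h2
  exact abs_le'.2 ⟨h1, neg_le_iff_add_nonneg.2 h2⟩

theorem norm_le_of_pos {S : X →L[ℝ] X} (hS : ∀ x ∈ posCone X, S x ∈ posCone X) {C : ℝ}
    (hC0 : 0 ≤ C) (hC : ∀ x, 0 ≤ x → ‖x‖ ≤ 1 → ‖S x‖ ≤ C) : ‖S‖ ≤ C := by
  refine S.opNorm_le_bound hC0 fun x => ?_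
  rcases eq_or_ne x 0 with rfl | hx0
  · simp
  have hxn : 0 < ‖x‖ := norm_pos_iff.2 hx0
  have h1 : ‖S x‖ ≤ ‖S |x|‖ := norm_le_norm_of_abs_le_abs ((abs_map_le hS x).trans (le_abs_self _))
  have h2 := hC (‖x‖⁻¹ • |x|) (smul_nonneg (by positivity) (abs_nonneg x)) (by
    rw [norm_smul, norm_abs_eq_norm, norm_inv, norm_norm, inv_mul_cancel₀ hxn.ne'])
  rw [map_smul, norm_smul, norm_inv, norm_norm, inv_mul_le_iff₀ hxn] at h2
  linarith

/-- If `X*` has the positive metric approximation property, then its identity is approximated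
at finitely many points by adjoints of positive finite rank operators on `X`. -/
theorem exists_posFiniteRank_adjoint_approx (hX : HasPMAP (StrongDual ℝ X) (dualPosCone X))
    {ν : Type*} [Fintype ν] (f : ν → StrongDual ℝ X) {ε : ℝ} (hε : 0 < ε) :
    ∃ S : X →L[ℝ] X, FiniteRank S ∧ (∀ x ∈ posCone X, S x ∈ posCone X) ∧ ‖S‖ ≤ 1 + ε ∧
      ∀ n, ‖(f n).comp S - f n‖ ≤ ε := by
  obtain ⟨Q, hQfin, hQpos, hQn, hQf⟩ := hX (ε / 2) (by positivity) (Set.range f)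
    (Set.finite_range f).isCompact
  obtain ⟨κ, _, g, φ, hg, hQ⟩ := exists_rankOne_decomposition hQfin hQpos
  set G : ℝ := ∑ j, ‖g j‖ with hG
  set M : ℝ := ∑ j, ‖φ j‖ with hM
  set Φ : ℝ := ∑ n, ‖f n‖ with hΦ
  have hG0 : 0 ≤ G := Finset.sum_nonneg fun _ _ => norm_nonneg _
  have hM0 : 0 ≤ M := Finset.sum_nonneg fun j _ => (φ j).opNorm_nonneg
  have hΦ0 : 0 ≤ Φ := Finset.sum_nonneg fun _ _ => norm_nonneg _
  set κ₀ : ℝ := ε / (8 * (1 + G) * (1 + Φ)) with hκ₀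
  have hκ₀0 : 0 < κ₀ := by positivity
  have hκε : κ₀ * (8 * (1 + G) * (1 + Φ)) = ε := div_mul_cancel₀ _ (by positivity)
  set δ : ℝ := κ₀ / (1 + M) with hδ
  have hδ0 : 0 < δ := by positivity
  have hδM : δ * M ≤ κ₀ := by
    have : δ * (1 + M) = κ₀ := div_mul_cancel₀ _ (by positivity)
    linarith
  set gs : StrongDual ℝ X := ∑ j, g j with hgs
  have hgs' : ∀ x, gs x = ∑ j, g j x := fun x => by simp [hgs, sum_apply]
  have hgj : ∀ x, 0 ≤ x → ∀ j, 0 ≤ g j x := fun x hx j => hg j x hx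
  have hgle : ∀ x, 0 ≤ x → ∀ j, g j x ≤ gs x := fun x hx j => by
    rw [hgs']
    exact Finset.single_le_sum (f := fun j => g j x) (fun j _ => hgj x hx j) (Finset.mem_univ j)
  -- `A₁` controls positivity after scaling to `gs x = 1`, and `A₂` controls the norm. Both infinite
  -- sets of conditions reduce to finite nets because `S₀` sees `x` only through the finitely many
  -- numbers `g j x`.
  let A₁ : Set X := {x | 0 ≤ x ∧ gs x = 1}
  let A₂ : Set X := {x | 0 ≤ x ∧ ‖x‖ ≤ 1}
  obtain ⟨s₁, hs₁, hfin₁, hnet₁⟩ := exists_finite_net A₁ (fun x j => g j x) (M := 1)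
    (fun x hx j => by
      rw [abs_of_nonneg (hgj x hx.1 j), ← hx.2]; exact hgle x hx.1 j) hδ0
  obtain ⟨s₂, hs₂, hfin₂, hnet₂⟩ := exists_finite_net A₂ (fun x j => g j x) (M := G)
    (fun x hx j => by
      refine ((g j).le_opNorm x).trans ((mul_le_of_le_one_right (norm_nonneg _) hx.2).trans ?_)
      exact Finset.single_le_sum (f := fun j => ‖g j‖) (fun j _ => norm_nonneg _)
        (Finset.mem_univ j)) hδ0
  have := hfin₁.fintype
  have := hfin₂.fintype
  let ι := s₁ ⊕ s₂
  let pt : ι → X := Sum.elim (fun x => x) (fun x => x)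
  -- On `A₁` every coefficient `g j x` is at most `1`, so the bidual image has norm at most `M`; on
  -- `A₂` the bound `1` comes from `‖Q‖ ≤ 1`.
  let r : ι → ℝ := Sum.elim (fun _ => M) (fun _ => 1)
  have hpt : ∀ i, 0 ≤ pt i := by
    rintro (x | x)
    exacts [(hs₁ x.2).1, (hs₂ x.2).1]
  have hQpt : ∀ i h, ∑ j, g j (pt i) * φ j h = Q h (pt i) := fun i h => by
    rw [hQ h, sum_apply]
    exact Finset.sum_congr rfl fun j _ => mul_comm _ _
  set η : ℝ := κ₀ / (1 + Fintype.card ι) with hη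
  have hη0 : 0 < η := by positivity
  have hηι : η + Fintype.card ι * η = κ₀ := by
    have : η * (1 + Fintype.card ι) = κ₀ := div_mul_cancel₀ _ (by positivity)
    linarith
  have hηκ : η ≤ κ₀ := by
    have : 0 ≤ Fintype.card ι * η := by positivity
    linarith
  obtain ⟨y, z, hy, hz, hyz, hfy⟩ := exists_approx_solution (fun i j => g j (pt i)) φ r
    (by rintro (x | x); exacts [hM0, zero_le_one])
    (fun i h hh => by rw [hQpt]; exact hQpos h hh _ (hpt i))
    (fun i h => by
      rcases i with x | x
      · change _ ≤ M * ‖h‖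
        refine (Finset.abs_sum_le_sum_abs _ _).trans ?_
        rw [hM, Finset.sum_mul]
        refine Finset.sum_le_sum fun j _ => ?_
        have hx := hs₁ x.2
        have h0 := hgj _ hx.1 j
        have h1 := hgle _ hx.1 j
        rw [hx.2] at h1
        change |g j x * φ j h| ≤ _
        rw [abs_mul, abs_of_nonneg h0]
        exact (mul_le_of_le_one_left (abs_nonneg _) h1).trans ((φ j).le_opNorm h)
      · rw [hQpt]
        have h1 : ‖Q h‖ ≤ 1 * ‖h‖ := (Q.le_opNorm h).trans
          (mul_le_mul_of_nonneg_right hQn (norm_nonneg h))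
        have h2 := (Q h).le_opNorm (pt (Sum.inr x))
        have h3 : ‖pt (Sum.inr x)‖ ≤ 1 := (hs₂ x.2).2
        exact (h2.trans (mul_le_of_le_one_right (norm_nonneg _) h3)).trans h1) f hη0
  -- The first summand dominates the errors at the net points, and the second the passage from a
  -- point to its neighbour in the net. Adding `gs ⊗ w` therefore makes `S₀` positive at a cost of
  -- order `κ₀`.
  set w : X := ∑ i, |∑ j, g j (pt i) • y j - z i| + δ • ∑ j, |y j| with hw
  have hw1 : ∀ i, |∑ j, g j (pt i) • y j - z i| ≤ ∑ i, |∑ j, g j (pt i) • y j - z i| := fun i =>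
    Finset.single_le_sum (f := fun i => |∑ j, g j (pt i) • y j - z i|)
      (fun i _ => abs_nonneg _) (Finset.mem_univ i)
  have hyM : ‖∑ j, |y j|‖ ≤ M := (norm_sum_le _ _).trans (Finset.sum_le_sum fun j _ => by
    rw [norm_abs_eq_norm]; exact hy j)
  have hδy : ‖δ • ∑ j, |y j|‖ ≤ κ₀ := by
    rw [norm_smul, Real.norm_of_nonneg hδ0.le]
    exact (mul_le_mul_of_nonneg_left hyM hδ0.le).trans hδM
  have hwn : ‖w‖ ≤ 2 * κ₀ := by
    have h1 : ‖∑ i, |∑ j, g j (pt i) • y j - z i|‖ ≤ Fintype.card ι * η := by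
      refine (norm_sum_le _ _).trans ((Finset.sum_le_sum (g := fun _ => η) fun i _ => ?_).trans ?_)
      · rw [norm_abs_eq_norm]; exact (hyz i).le
      · simp
    have := norm_add_le (∑ i, |∑ j, g j (pt i) • y j - z i|) (δ • ∑ j, |y j|)
    rw [← hw] at this
    linarith
  let S₀ : X →L[ℝ] X := ∑ j, (g j).smulRight (y j)
  let S : X →L[ℝ] X := S₀ + gs.smulRight w
  have hS₀ : ∀ x, S₀ x = ∑ j, g j x • y j := fun x => by simp [S₀, sum_apply]
  have hS : ∀ x, S x = S₀ x + gs x • w := fun x => rfl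
  have hclose : ∀ x x' : X, (∀ j, |g j x - g j x'| ≤ δ) →
      |S₀ x - S₀ x'| ≤ δ • ∑ j, |y j| := by
    intro x x' h
    rw [hS₀, hS₀, ← Finset.sum_sub_distrib, Finset.smul_sum]
    refine (Finset.le_sum_of_subadditive (abs : X → X) abs_zero.le abs_add_le _ _).trans
      (Finset.sum_le_sum fun j _ => ?_)
    rw [← sub_smul]
    exact (abs_smul_le _ _).trans (smul_le_smul_of_nonneg_right (h j) (abs_nonneg _))
  have hS₀pt : ∀ i, |S₀ (pt i) - z i| ≤ ∑ i, |∑ j, g j (pt i) • y j - z i| := fun i => by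
    rw [hS₀]; exact hw1 i
  have hSpos : ∀ x ∈ posCone X, S x ∈ posCone X := by
    intro x hx
    change 0 ≤ S x
    rcases (show 0 ≤ gs x from (Finset.sum_nonneg fun j _ => hgj x hx j).trans
      (hgs' x).ge).eq_or_lt with h0 | h0
    · have hz0 : ∀ j, g j x = 0 := fun j =>
        le_antisymm ((hgle x hx j).trans h0.ge) (hgj x hx j)
      rw [hS, hS₀, ← h0]
      simp [hz0]
    · have hx' : (gs x)⁻¹ • x ∈ A₁ := ⟨smul_nonneg (by positivity) hx, by
        rw [map_smul, smul_eq_mul, inv_mul_cancel₀ h0.ne']⟩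
      obtain ⟨x', hx's, hxx'⟩ := hnet₁ _ hx'
      have h1 := hclose _ x' hxx'
      have h2 := hS₀pt (Sum.inl ⟨x', hx's⟩)
      have h3 := (hz (Sum.inl ⟨x', hx's⟩)).1
      change |S₀ x' - _| ≤ _ at h2
      have h4 : 0 ≤ S₀ ((gs x)⁻¹ • x) + w := by
        have e1 := (neg_le_abs (S₀ ((gs x)⁻¹ • x) - S₀ x')).trans h1
        have e2 := (neg_le_abs _).trans h2
        have e3 := add_le_add (add_le_add e1 e2) (neg_nonpos.2 h3)
        rw [hw]
        rw [← sub_nonneg] at e3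
        refine e3.trans (le_of_eq ?_)
        abel
      have h5 : S x = gs x • (S₀ ((gs x)⁻¹ • x) + w) := by
        rw [smul_add, map_smul, smul_inv_smul₀ h0.ne', hS]
      rw [h5]
      exact smul_nonneg h0.le h4
  have hgsx : ∀ x, |gs x| ≤ G * ‖x‖ := fun x => (gs.le_opNorm x).trans
    (mul_le_mul_of_nonneg_right (norm_sum_le _ _) (norm_nonneg x))
  have hSn : ‖S‖ ≤ 1 + ε := by
    refine norm_le_of_pos hSpos (by positivity) fun x hx hx1 => ?_
    obtain ⟨x', hx's, hxx'⟩ := hnet₂ x ⟨hx, hx1⟩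
    have h1 : ‖S₀ x - S₀ x'‖ ≤ κ₀ := by
      refine le_trans ?_ hδy
      rw [← norm_abs_eq_norm]
      exact norm_le_norm_of_nonneg_of_le (abs_nonneg _) (hclose x x' hxx')
    have h2 : ‖S₀ x' - z (Sum.inr ⟨x', hx's⟩)‖ < η := by
      rw [hS₀]; exact hyz (Sum.inr ⟨x', hx's⟩)
    have h3 : ‖z (Sum.inr ⟨x', hx's⟩)‖ ≤ 1 := (hz (Sum.inr ⟨x', hx's⟩)).2
    have h4 : ‖gs x • w‖ ≤ G * (2 * κ₀) := by
      rw [norm_smul]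
      exact mul_le_mul ((hgsx x).trans (mul_le_of_le_one_right hG0 hx1)) hwn (norm_nonneg _) hG0
    have h5 : S x = (S₀ x - S₀ x') + (S₀ x' - z (Sum.inr ⟨x', hx's⟩)) + z (Sum.inr ⟨x', hx's⟩)
        + gs x • w := by rw [hS]; abel
    have h6 := norm_add₄_le (a := S₀ x - S₀ x') (b := S₀ x' - z (Sum.inr ⟨x', hx's⟩))
      (c := z (Sum.inr ⟨x', hx's⟩)) (d := gs x • w)
    rw [← h5] at h6
    have h7 : 0 ≤ κ₀ * (G * Φ) := by positivity
    have h8 : 0 ≤ κ₀ * G := by positivity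
    have h9 : 0 ≤ κ₀ * Φ := by positivity
    nlinarith
  refine ⟨S, ?_, hSpos, hSn, fun n => ?_⟩
  · refine finiteRank_of_forall_mem_span (s := insert w (Set.range y))
      ((Set.finite_range y).insert w) fun x => ?_
    rw [hS, hS₀]
    refine Submodule.add_mem _ (Submodule.sum_mem _ fun j _ => Submodule.smul_mem _ _
      (Submodule.subset_span (Set.mem_insert_of_mem _ ⟨j, rfl⟩)))
      (Submodule.smul_mem _ _ (Submodule.subset_span (Set.mem_insert _ _)))
  · have h1 : ‖(f n).comp S - Q (f n)‖ ≤ ε / 2 := by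
      refine ContinuousLinearMap.opNorm_le_bound _ (by positivity) fun x => ?_
      have e1 : ((f n).comp S - Q (f n)) x =
          ∑ j, (f n (y j) - φ j (f n)) * g j x + gs x * f n w := by
        change f n (S x) - Q (f n) x = _
        have hQx : Q (f n) x = ∑ j, φ j (f n) * g j x := by rw [hQ, sum_apply]; rfl
        rw [hS, hS₀, hQx, map_add, map_sum]
        simp only [map_smul, smul_eq_mul, sub_mul, Finset.sum_sub_distrib]
        simp only [mul_comm (f n _)]
        ring
      rw [e1]
      have e2 : |∑ j, (f n (y j) - φ j (f n)) * g j x| ≤ κ₀ * G * ‖x‖ := by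
        refine (Finset.abs_sum_le_sum_abs _ _).trans ?_
        rw [hG, Finset.mul_sum, Finset.sum_mul]
        refine Finset.sum_le_sum fun j _ => ?_
        rw [abs_mul, mul_assoc]
        exact mul_le_mul ((hfy n j).le.trans hηκ) ((g j).le_opNorm x) (abs_nonneg _) hκ₀0.le
      have e3 : |gs x * f n w| ≤ G * ‖x‖ * (Φ * (2 * κ₀)) := by
        rw [abs_mul]
        refine mul_le_mul (hgsx x) (((f n).le_opNorm w).trans ?_) (abs_nonneg _) (by positivity)
        exact mul_le_mul (Finset.single_le_sum (f := fun n => ‖f n‖) (fun n _ => norm_nonneg _)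
          (Finset.mem_univ n)) hwn (norm_nonneg _) hΦ0
      refine (norm_add_le _ _).trans ?_
      refine (add_le_add e2 e3).trans ?_
      have e4 : κ₀ * G + G * (Φ * (2 * κ₀)) ≤ ε / 2 := by
        have h7 : 0 ≤ κ₀ * (G * Φ) := by positivity
        have h8 : 0 ≤ κ₀ * G := by positivity
        have h9 : 0 ≤ κ₀ * Φ := by positivity
        nlinarith
      have := mul_le_mul_of_nonneg_right e4 (norm_nonneg x)
      linarith
    have h2 := hQf (f n) ⟨n, rfl⟩
    have h3 := norm_add_le ((f n).comp S - Q (f n)) (Q (f n) - f n)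
    rw [sub_add_sub_cancel] at h3
    linarith

end PositiveApproximation

/-! ### Perturbation argument for finite exponents -/

theorem tendsto_strongNorm_tail {E : Type*} [NormedAddCommGroup E]
    [NormedSpace ℝ E] {p : ℝ≥0∞}
    (hp : 1 ≤ p) (hp' : p ≠ ∞) {a : ℕ → E} (ha : strongNorm p a < ∞) :
    Tendsto (fun N => strongNorm p fun n => a (n + N)) atTop (𝓝 0) := by
  have h0 := toReal_pos_of_one_le hp hp'
  -- Tails of a convergent series tend to zero. For the supremum norm this fails, which forces a
  -- different argument at `p = ∞`.
  have hfin : ∑' n, ‖a n‖ₑ ^ p.toReal ≠ ∞ := by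
    intro h
    rw [strongNorm_of_ne_top hp', h, ENNReal.top_rpow_of_pos (by positivity)] at ha
    exact lt_irrefl _ ha
  have h1 := ENNReal.tendsto_sum_nat_add _ hfin
  have h2 := (ENNReal.continuous_rpow_const (y := 1 / p.toReal)).tendsto 0 |>.comp h1
  rw [ENNReal.zero_rpow_of_pos (by positivity)] at h2
  simpa [strongNorm, hp', Function.comp_def] using h2

section TwoSided

variable {X : Type u} {E : Type v} [NormedAddCommGroup X] [Lattice X] [IsOrderedAddMonoid X]
  [HasSolidNorm X] [NormedSpace ℝ X] [IsOrderedModule ℝ X] [NormedAddCommGroup E]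
  [NormedSpace ℝ E]

theorem IsPosNuclearRep.tail {p : ℝ≥0∞} (hp : 1 ≤ p) {T : X →L[ℝ] E} {f : ℕ → StrongDual ℝ X}
    {a : ℕ → E} (h : IsPosNuclearRep p T f a) (N : ℕ) :
    IsPosNuclearRep p (T - ∑ n ∈ Finset.range N, (f n).smulRight (a n))
      (fun n => f (n + N)) (fun n => a (n + N)) where
  pos n := h.pos (n + N)
  weak_lt_top := (weakNorm_comp_injective_le (one_le_conjExponent p) f
    (add_left_injective N)).trans_lt h.weak_lt_top
  strong_lt_top := (strongNorm_comp_injective_le hp a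
    (add_left_injective N)).trans_lt h.strong_lt_top
  hasSum x := by
    rw [hasSum_nat_add_iff (f := fun n => f n x • a n) N]
    simpa [sum_apply] using h.hasSum x

/-- The identity `T = RTS + (T - T₀) - R(T - T₀)S + (T₀ - RT₀S)` isolates the term governed by `C`.
The tail terms are small by the choice of `N`, the last one by the approximation of finitely many
functionals and vectors. -/
theorem hasBalancedRep_of_bound [CompleteSpace X] [CompleteSpace E] {p : ℝ≥0∞} (hp : 1 ≤ p)
    (hp' : p ≠ ∞) (hX : HasPMAP (StrongDual ℝ X) (dualPosCone X)) (hE : HasMAP E)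
    {T : X →L[ℝ] E} (hT : IsPosNuclear p T) {C : ℝ} (hC : IsPosIntegralBound p T C) {s : ℝ≥0}
    (hs : C < s * s) : HasBalancedRep p T s := by
  obtain ⟨f, a, hfa⟩ := hT
  obtain ⟨hC0, hC⟩ := hC
  obtain ⟨r, hrs, hr⟩ : ∃ r : ℝ≥0, r < s ∧ C < r * r := by
    refine ⟨NNReal.sqrt ((⟨C, hC0.le⟩ + s * s) / 2), ?_, ?_⟩
    · refine lt_of_pow_lt_pow_left₀ 2 zero_le ?_
      rw [NNReal.sq_sqrt, ← NNReal.coe_lt_coe]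
      push_cast
      change (C + s * s) / 2 < s ^ 2
      nlinarith
    · rw [← NNReal.coe_mul, NNReal.mul_self_sqrt]
      push_cast
      change C < (C + s * s) / 2
      linarith
  -- Three error terms of radius `η` fit between `r` and `s`.
  set η : ℝ≥0 := (s - r) / 4 with hη
  have hη0 : 0 < η := div_pos (tsub_pos_of_lt hrs) (by norm_num)
  have hsum : r + (η + η + η) ≤ s := by
    have h1 : s = r + (s - r) := (add_tsub_cancel_of_le hrs.le).symm
    have h2 : s - r = η + η + η + η := by rw [hη]; ring
    rw [h1, h2]
    gcongr
    exact le_self_add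
  -- The factor `2` absorbs `‖S‖ ≤ 2` in the term `R(T - T₀)S`.
  obtain ⟨N, hN⟩ : ∃ N, 2 * (weakNorm p.conjExponent f * strongNorm p fun n => a (n + N)) <
      (η : ℝ≥0∞) * η := by
    have h1 := ENNReal.Tendsto.const_mul (a := 2) (ENNReal.Tendsto.const_mul
      (a := weakNorm p.conjExponent f) (tendsto_strongNorm_tail hp hp' hfa.strong_lt_top)
      (Or.inr hfa.weak_lt_top.ne)) (Or.inr (by norm_num))
    rw [mul_zero, mul_zero] at h1
    have h2 : (0 : ℝ≥0∞) < η * η := by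
      have := ENNReal.coe_pos.2 hη0
      exact ENNReal.mul_pos this.ne' this.ne'
    exact (h1.eventually (gt_mem_nhds h2)).exists
  -- Each index contributes two rank one errors, each of radius `ρ + ρ`.
  set ρ : ℝ≥0 := η / (4 * (N + 1)) with hρ
  have hρ0 : 0 < ρ := by positivity
  have hρN : (N : ℝ≥0) * ((ρ + ρ) + (ρ + ρ)) ≤ η := by
    have : η = 4 * (N + 1) * ρ := by rw [hρ]; field_simp
    rw [this, ← NNReal.coe_le_coe]
    push_cast
    have := ρ.coe_nonneg
    linarith
  set B : ℝ := ∑ n ∈ Finset.range N, (‖f n‖ + ‖a n‖) with hB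
  have hB0 : 0 ≤ B := Finset.sum_nonneg fun _ _ => by positivity
  have hBn : ∀ n ∈ Finset.range N, ‖f n‖ + ‖a n‖ ≤ B := fun n hn =>
    Finset.single_le_sum (f := fun n => ‖f n‖ + ‖a n‖) (fun _ _ => by positivity) hn
  set ε₁ : ℝ := (r * r - C) / (2 * C) with hε₁
  have hε₁0 : 0 < ε₁ := div_pos (sub_pos.2 hr) (by positivity)
  have hε₁C : C * (1 + ε₁) < r * r := by
    have : C * ε₁ = (r * r - C) / 2 := by rw [hε₁]; field_simp
    linarith
  set ε₂ : ℝ := ρ * ρ / (4 * (B + 1)) with hε₂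
  have hε₂0 : 0 < ε₂ := by positivity
  have hε₂B : 4 * (B * ε₂) ≤ ρ * ρ := by
    have : 4 * (B + 1) * ε₂ = ρ * ρ := by rw [hε₂]; field_simp
    linarith
  set ε : ℝ := min (min ε₁ ε₂) 1 with hε
  have hε0 : 0 < ε := lt_min (lt_min hε₁0 hε₂0) one_pos
  have hεle₁ : ε ≤ ε₁ := (min_le_left _ _).trans (min_le_left _ _)
  have hεle₂ : ε ≤ ε₂ := (min_le_left _ _).trans (min_le_right _ _)
  have hεle : ε ≤ 1 := min_le_right _ _
  obtain ⟨S, hSfin, hSpos, hSn, hSf⟩ :=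
    exists_posFiniteRank_adjoint_approx hX (fun n : Fin N => f n) hε0
  obtain ⟨R, hRfin, hRn, hRa⟩ := hE ε hε0 (Set.range fun n : Fin N => a n)
    (Set.finite_range _).isCompact
  set T₀ : X →L[ℝ] E := ∑ n ∈ Finset.range N, (f n).smulRight (a n) with hT₀
  have htail := hfa.tail hp N
  rw [← hT₀] at htail
  have hRTS : HasBalancedRep p (R.comp (T.comp S)) r := by
    refine hasBalancedRep_of_posNuclearNorm_lt hp ((hC X E S R hSfin hSpos hRfin).trans_lt ?_)
    rw [← ENNReal.ofReal_coe_nnreal, ← ENNReal.ofReal_mul r.coe_nonneg]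
    refine (ENNReal.ofReal_lt_ofReal_iff_of_nonneg (by positivity)).2 (lt_of_le_of_lt ?_ hε₁C)
    have : ‖R‖ * ‖S‖ ≤ 1 * (1 + ε₁) :=
      mul_le_mul hRn (hSn.trans (by linarith)) (norm_nonneg _) zero_le_one
    rw [mul_assoc]
    exact mul_le_mul_of_nonneg_left (this.trans (one_mul _).le) hC0.le
  have h₁ : HasBalancedRep p (T - T₀) η := by
    refine hasBalancedRep_of_weak_mul_strong_le hp htail hη0 ?_
    refine (mul_le_mul_left (weakNorm_comp_injective_le (one_le_conjExponent p) f
      (add_left_injective N)) _).trans (le_trans ?_ hN.le)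
    rw [two_mul]
    exact le_self_add
  have h₂ : HasBalancedRep p (R.comp ((T - T₀).comp S)) η := by
    obtain ⟨e0, e1, e2⟩ := htail.comp hp hSpos R
    refine hasBalancedRep_of_weak_mul_strong_le hp e0 hη0
      ((mul_le_mul' e1 e2).trans (le_trans ?_ hN.le))
    have hS2 : ‖S‖ₑ ≤ 2 := by
      rw [← ofReal_norm]
      exact (ENNReal.ofReal_le_ofReal (hSn.trans (by linarith : _ ≤ (2 : ℝ)))).trans (by simp)
    have hR1 : ‖R‖ₑ ≤ 1 := by
      rw [← ofReal_norm]
      exact (ENNReal.ofReal_le_ofReal hRn).trans (by simp)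
    calc _ ≤ 2 * weakNorm p.conjExponent f * (1 * strongNorm p fun n => a (n + N)) := by
          gcongr
          exact weakNorm_comp_injective_le (one_le_conjExponent p) f (add_left_injective N)
      _ = _ := by ring
  have h₃ : HasBalancedRep p (T₀ - R.comp (T₀.comp S)) η := by
    -- Changing the functional first and the vector second leaves one small factor in each rank one
    -- term.
    have e : T₀ - R.comp (T₀.comp S) = ∑ n ∈ Finset.range N,
        ((f n - (f n).comp S).smulRight (a n) +
          ((f n).comp S).smulRight (a n - R (a n))) := by
      ext x
      simp [hT₀, sum_apply, ← Finset.sum_sub_distrib, sub_smul, smul_sub]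
    rw [e]
    refine (HasBalancedRep.sum hp (Finset.range N) (r := fun _ => (ρ + ρ) + (ρ + ρ))
      fun n hn => ?_).mono (by simpa only [Finset.sum_const, Finset.card_range, nsmul_eq_mul] using hρN)
    have hn' := Finset.mem_range.1 hn
    have hbn := hBn n hn
    have hf0 := norm_nonneg (f n)
    have ha0 := norm_nonneg (a n)
    refine (hasBalancedRep_smulRight hp _ _ hρ0 ?_).add hp
      (hasBalancedRep_smulRight hp _ _ hρ0 ?_)
    · have d1 : ‖f n - (f n).comp S‖ ≤ ε₂ := by
        rw [norm_sub_rev]; exact (hSf ⟨n, hn'⟩).trans hεle₂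
      have d2 : ‖f n - (f n).comp S‖ * ‖a n‖ ≤ ε₂ * B :=
        mul_le_mul d1 (by linarith) ha0 hε₂0.le
      nlinarith
    · have d1 : ‖a n - R (a n)‖ ≤ ε₂ := by
        rw [norm_sub_rev]; exact (hRa (a n) ⟨⟨n, hn'⟩, rfl⟩).le.trans hεle₂
      have d2 : ‖(f n).comp S‖ ≤ B * 2 := ((f n).opNorm_comp_le S).trans
        (mul_le_mul (by linarith) (by linarith) (norm_nonneg _) hB0)
      have d3 : ‖(f n).comp S‖ * ‖a n - R (a n)‖ ≤ B * 2 * ε₂ :=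
        mul_le_mul d2 d1 (norm_nonneg _) (by positivity)
      nlinarith
  have hdecomp : T = R.comp (T.comp S) + ((T - T₀) + -(R.comp ((T - T₀).comp S)) +
      (T₀ - R.comp (T₀.comp S))) := by
    ext x
    simp only [add_apply, sub_apply, neg_apply, ContinuousLinearMap.comp_apply, map_sub]
    abel
  rw [hdecomp]
  exact (hRTS.add hp ((h₁.add hp (h₂.neg hp)).add hp h₃)).mono hsum

theorem posNuclearNorm_le_of_hasBalancedRep {p : ℝ≥0∞} {T : X →L[ℝ] E} {C : ℝ} (hC : 0 ≤ C)
    (h : ∀ s : ℝ≥0, C < s * s → HasBalancedRep p T s) : posNuclearNorm p T ≤ ENNReal.ofReal C := by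
  refine ENNReal.le_of_forall_pos_le_add fun ε hε _ => ?_
  have hs := NNReal.mul_self_sqrt (C.toNNReal + ε)
  have := (h (NNReal.sqrt (C.toNNReal + ε)) (by
    rw [← NNReal.coe_mul, hs, NNReal.coe_add, Real.coe_toNNReal C hC]
    exact lt_add_of_pos_right _ hε)).posNuclearNorm_le
  rw [← ENNReal.coe_mul, hs, ENNReal.coe_add] at this
  exact this

end TwoSided

/-! ### The weak one-norm and cone summability -/

section WeakOne

variable {X : Type*} [NormedAddCommGroup X] [Lattice X] [IsOrderedAddMonoid X] [HasSolidNorm X]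
  [NormedSpace ℝ X] {E : Type*} [NormedAddCommGroup E] [NormedSpace ℝ E]

theorem strongNorm_one (a : ℕ → E) : strongNorm 1 a = ∑' n, ‖a n‖ₑ := by simp [strongNorm]

theorem abs_apply_le {f : StrongDual ℝ X} (hf : f ∈ dualPosCone X) (x : X) : |f x| ≤ f |x| := by
  have h1 : 0 ≤ f (|x| - x) := hf _ (sub_nonneg.2 (le_abs_self x))
  have h2 : 0 ≤ f (|x| + x) := hf _ (by
    have := sub_nonneg.2 (neg_le_abs x); rwa [sub_neg_eq_add] at this)
  rw [map_sub, sub_nonneg] at h1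
  rw [map_add] at h2
  exact abs_le'.2 ⟨h1, by linarith⟩

theorem tsum_enorm_apply_le (f : ℕ → StrongDual ℝ X) (x : X) :
    ∑' n, ‖f n x‖ₑ ≤ ‖x‖ₑ * weakNorm 1 f := by
  have h := strongNorm_apply_le le_rfl f (NormedSpace.inclusionInDoubleDual ℝ X x)
  rw [strongNorm_one] at h
  refine h.trans (mul_le_mul_left ?_ _)
  rw [← ofReal_norm, ← ofReal_norm]
  exact ENNReal.ofReal_le_ofReal (NormedSpace.double_dual_bound ℝ X x)

/-- For positive functionals, signs do not matter: `|∑ σₙ fₙ(x)| ≤ ∑ fₙ(|x|)`. Taking the signs of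
`φ (f n)` turns the absolute sum into `φ` of one signed sum. -/
theorem weakNorm_one_le {f : ℕ → StrongDual ℝ X} (hf : ∀ n, f n ∈ dualPosCone X) {c : ℝ}
    (hc : 0 ≤ c) (h : ∀ (s : Finset ℕ) (x : X), 0 ≤ x → ∑ n ∈ s, f n x ≤ c * ‖x‖) :
    weakNorm 1 f ≤ ENNReal.ofReal c := by
  refine weakNorm_le fun φ hφ => ?_
  rw [strongNorm_one, ENNReal.tsum_eq_iSup_sum]
  refine iSup_le fun s => ?_
  let σ : ℕ → ℝ := fun n => SignType.sign (φ (f n))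
  have hσ : ∀ n, |σ n| ≤ 1 := fun n => by
    rcases lt_trichotomy (φ (f n)) 0 with h | h | h <;> simp [σ, h]
  have hn : ‖∑ n ∈ s, σ n • f n‖ ≤ c := by
    refine ContinuousLinearMap.opNorm_le_bound _ hc fun x => ?_
    rw [sum_apply, Real.norm_eq_abs]
    refine (Finset.abs_sum_le_sum_abs _ _).trans ?_
    refine le_trans (Finset.sum_le_sum fun n _ => ?_) ((h s |x| (abs_nonneg x)).trans_eq (by
      rw [norm_abs_eq_norm]))
    change |σ n * f n x| ≤ _
    rw [abs_mul]
    exact (mul_le_of_le_one_left (abs_nonneg _) (hσ n)).trans (abs_apply_le (hf n) x)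
  have e : ∑ n ∈ s, |φ (f n)| = φ (∑ n ∈ s, σ n • f n) := by
    rw [map_sum]
    refine Finset.sum_congr rfl fun n _ => ?_
    rw [map_smul, smul_eq_mul]
    exact (sign_mul_self _).symm
  have : ∑ n ∈ s, ‖φ (f n)‖ₑ = ENNReal.ofReal (∑ n ∈ s, |φ (f n)|) := by
    rw [ENNReal.ofReal_sum_of_nonneg fun _ _ => abs_nonneg _]
    exact Finset.sum_congr rfl fun n _ => by rw [← ofReal_norm, Real.norm_eq_abs]
  rw [this, e]
  refine ENNReal.ofReal_le_ofReal ((le_abs_self _).trans ((φ.le_opNorm _).trans ?_))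
  exact (mul_le_of_le_one_left (norm_nonneg _) hφ).trans hn

/-- A positively `∞`-nuclear operator is cone absolutely summing. -/
theorem IsPosNuclearRep.sum_enorm_le {T : X →L[ℝ] E} {f : ℕ → StrongDual ℝ X} {a : ℕ → E}
    (h : IsPosNuclearRep ∞ T f a) {ι : Type*} (s : Finset ι) (x : ι → X) (hx : ∀ i, 0 ≤ x i) :
    ∑ i ∈ s, ‖T (x i)‖ₑ ≤
      ‖∑ i ∈ s, x i‖ₑ * (weakNorm (ENNReal.conjExponent ∞) f * strongNorm ∞ a) := by
  have e1 : ENNReal.conjExponent ∞ = 1 := by simp [ENNReal.conjExponent]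
  rw [e1, ← mul_assoc]
  have h1 : ∀ i, ‖T (x i)‖ₑ ≤ ∑' n, ‖f n (x i)‖ₑ * strongNorm ∞ a := fun i => by
    rw [← (h.hasSum (x i)).tsum_eq]
    refine enorm_tsum_le_tsum_enorm.trans (ENNReal.tsum_le_tsum fun n => ?_)
    rw [enorm_smul]
    refine mul_le_mul_right ?_ _
    rw [strongNorm_top]
    exact le_iSup (fun n => ‖a n‖ₑ) n
  refine (Finset.sum_le_sum fun i _ => h1 i).trans ?_
  simp only [ENNReal.tsum_mul_right]
  rw [← Finset.sum_mul]
  refine mul_le_mul_left ?_ _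
  rw [← Summable.tsum_finsetSum fun _ _ => ENNReal.summable]
  refine le_trans (le_of_eq ?_) (tsum_enorm_apply_le f _)
  refine tsum_congr fun n => ?_
  rw [map_sum, ← ofReal_norm, Real.norm_of_nonneg (Finset.sum_nonneg fun i _ => h.pos n _ (hx i)),
    ENNReal.ofReal_sum_of_nonneg fun i _ => h.pos n _ (hx i)]
  refine Finset.sum_congr rfl fun i _ => ?_
  rw [← ofReal_norm, Real.norm_of_nonneg (h.pos n _ (hx i))]

theorem sum_enorm_le_posNuclearNorm {T : X →L[ℝ] E} {ι : Type*} (s : Finset ι) (x : ι → X)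
    (hx : ∀ i, 0 ≤ x i) (hn : ‖∑ i ∈ s, x i‖ ≤ 1) :
    ∑ i ∈ s, ‖T (x i)‖ₑ ≤ posNuclearNorm ∞ T := by
  refine le_iInf fun f => le_iInf fun a => le_iInf fun h => (h.sum_enorm_le s x hx).trans ?_
  refine mul_le_of_le_one_left' ?_
  rw [← ofReal_norm]
  exact (ENNReal.ofReal_le_ofReal hn).trans (by simp)

end WeakOne

theorem hasSolidNorm_pi (ι : Type*) [Fintype ι] : HasSolidNorm (ι → ℝ) where
  solid x y h := by
    rw [pi_norm_le_iff_of_nonneg (norm_nonneg y)]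
    exact fun i => (h i).trans (norm_le_pi_norm y i)

/-! ### Integral operators at the infinite exponent are cone absolutely summing -/

section ConeSumming

variable {X : Type u} {E : Type v} [NormedAddCommGroup X] [Lattice X] [IsOrderedAddMonoid X]
  [HasSolidNorm X] [NormedSpace ℝ X] [IsOrderedModule ℝ X] [NormedAddCommGroup E]
  [NormedSpace ℝ E] [CompleteSpace E]

/-- A positively `∞`-integral operator into a space with the metric approximation property is
cone absolutely summing. -/
theorem sum_norm_le_of_bound (hE : HasMAP E) {T : X →L[ℝ] E} {C : ℝ}
    (hC : IsPosIntegralBound ∞ T C) {n : ℕ} (x : Fin n → X) (hx : ∀ i, 0 ≤ x i) :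
    ∑ i, ‖T (x i)‖ ≤ C * ‖∑ i, x i‖ := by
  obtain ⟨hC0, hC⟩ := hC
  refine le_of_forall_pos_le_add fun ε hε => ?_
  set ε' : ℝ := ε / (n + 1) with hε'
  have hε'0 : 0 < ε' := by positivity
  obtain ⟨R, hRfin, hRn, hRx⟩ := hE ε' hε'0 (Set.range fun i => T (x i))
    (Set.finite_range _).isCompact
  -- The unit vectors of this sup-normed lattice go to the `xᵢ`, and solidity gives `‖S‖ ≤ ‖∑ xᵢ‖`.
  -- The lift places `Y` in the universe of `X`.
  let Y := ULift.{u} (Fin n) → ℝ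
  have : HasSolidNorm Y := hasSolidNorm_pi _
  let S : Y →L[ℝ] X := ∑ i, (ContinuousLinearMap.proj (R := ℝ) (φ := fun _ : ULift.{u} (Fin n) => ℝ)
    (ULift.up i)).smulRight (x i)
  have hS : ∀ y : Y, S y = ∑ i, y (ULift.up i) • x i := fun y => by
    simp only [S, sum_apply]
    rfl
  have hSpos : ∀ y ∈ posCone Y, S y ∈ posCone X := fun y hy => by
    change 0 ≤ S y
    rw [hS]
    exact Finset.sum_nonneg fun i _ => smul_nonneg (hy _) (hx i)
  have hSfin : FiniteRank S := finiteRank_of_forall_mem_span (Set.finite_range x) fun y => by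
    rw [hS]
    exact Submodule.sum_mem _ fun i _ => Submodule.smul_mem _ _ (Submodule.subset_span ⟨i, rfl⟩)
  have hSn : ‖S‖ ≤ ‖∑ i, x i‖ := by
    refine S.opNorm_le_bound (norm_nonneg _) fun y => ?_
    have h1 : |S y| ≤ ‖y‖ • ∑ i, x i := by
      rw [hS, Finset.smul_sum]
      refine (Finset.le_sum_of_subadditive (abs : X → X) abs_zero.le abs_add_le _ _).trans
        (Finset.sum_le_sum fun i _ => (abs_smul_le _ _).trans ?_)
      rw [abs_of_nonneg (hx i)]
      exact smul_le_smul_of_nonneg_right (norm_le_pi_norm y _) (hx i)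
    have h2 := norm_le_norm_of_nonneg_of_le (abs_nonneg _) h1
    rwa [norm_abs_eq_norm, norm_smul, norm_norm, mul_comm] at h2
  let e : Fin n → Y := fun i => Pi.single (ULift.up i) 1
  have he : ∀ i, S (e i) = x i := fun i => by
    rw [hS, Finset.sum_eq_single i]
    · simp [e]
    · intro j _ hj
      have : (ULift.up j : ULift.{u} (Fin n)) ≠ ULift.up i := fun h => hj (ULift.up_injective h)
      simp [e, Pi.single_eq_of_ne this]
    · simp
  have h1 := (sum_enorm_le_posNuclearNorm (T := R.comp (T.comp S)) Finset.univ e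
    (fun i => by
      change (0 : ULift.{u} (Fin n) → ℝ) ≤ Pi.single (ULift.up i) 1
      exact Pi.single_nonneg.2 zero_le_one) (by
      rw [pi_norm_le_iff_of_nonneg zero_le_one]
      rintro ⟨j⟩
      rw [Finset.sum_apply, Finset.sum_eq_single j]
      · simp [e]
      · intro i _ hi
        have : (ULift.up j : ULift.{u} (Fin n)) ≠ ULift.up i :=
          fun h => hi (ULift.up_injective h).symm
        simp [e, Pi.single_eq_of_ne this]
      · simp)).trans (hC Y E S R hSfin hSpos hRfin)
  have h2 : ∑ i, ‖R (T (x i))‖ ≤ C * ‖R‖ * ‖S‖ := by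
    rw [← ENNReal.ofReal_le_ofReal_iff (by positivity),
      ENNReal.ofReal_sum_of_nonneg fun _ _ => norm_nonneg _]
    refine le_trans (le_of_eq (Finset.sum_congr rfl fun i _ => ?_)) h1
    rw [ofReal_norm]
    simp [he]
  have h3 : C * ‖R‖ * ‖S‖ ≤ C * ‖∑ i, x i‖ :=
    mul_le_mul (mul_le_of_le_one_right hC0.le hRn) hSn (norm_nonneg _) hC0.le
  have h4 : ∀ i, ‖T (x i)‖ ≤ ‖R (T (x i))‖ + ε' := fun i => by
    have h5 := (hRx (T (x i)) ⟨i, rfl⟩).le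
    have h6 := norm_sub_norm_le (T (x i)) (R (T (x i)))
    rw [norm_sub_rev] at h6
    linarith
  have h5 : ∑ i, ‖T (x i)‖ ≤ ∑ i, ‖R (T (x i))‖ + n * ε' := by
    refine (Finset.sum_le_sum fun i _ => h4 i).trans (le_of_eq ?_)
    simp [Finset.sum_add_distrib]
  have h6 : n * ε' ≤ ε := by
    have : (n + 1) * ε' = ε := by rw [hε']; field_simp
    linarith
  linarith

theorem total_norm_le_of_bound (hE : HasMAP E) {T : X →L[ℝ] E} {C : ℝ}
    (hC : IsPosIntegralBound ∞ T C) {x : X} (π : Partition x) :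
    π.total (fun y => ‖T y‖) ≤ C * ‖x‖ := by
  obtain ⟨s, hs, hsx⟩ := π
  induction s using Quotient.inductionOn with
  | _ l =>
    have h := sum_norm_le_of_bound hE hC (fun i : Fin l.length => l.get i)
      (fun i => hs _ (List.get_mem l i))
    have e1 : ∑ i : Fin l.length, l.get i = x := by
      rw [← hsx]
      simp
    have e2 : ∑ i : Fin l.length, ‖T (l.get i)‖ = (l.map fun y => ‖T y‖).sum := by
      rw [← Fin.sum_univ_fun_getElem]
      rfl
    rw [e1, e2] at h
    simpa [Partition.total] using h

end ConeSumming

/-! ### Limits of totals and series of positive functionals -/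

section PartitionTotals

variable {X : Type*} [NormedAddCommGroup X] [Lattice X] [IsOrderedAddMonoid X] [HasSolidNorm X]
  [NormedSpace ℝ X] {E : Type*} [NormedAddCommGroup E] [NormedSpace ℝ E]

theorem Partition.total_map {V W : Type*} [AddCommMonoid V] [AddCommMonoid W] {x : X}
    (π : Partition x) (h : V →+ W) (ψ : X → V) : π.total (fun y => h (ψ y)) = h (π.total ψ) := by
  simp [Partition.total, map_multiset_sum, Multiset.map_map]

theorem Partition.total_finset_sum {V ι : Type*} [AddCommMonoid V] {x : X} (π : Partition x)
    (s : Finset ι) (ψ : ι → X → V) :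
    π.total (fun y => ∑ i ∈ s, ψ i y) = ∑ i ∈ s, π.total (ψ i) := by
  classical
  induction s using Finset.induction_on with
  | empty => simp [Partition.total]
  | insert i s hi ih => simp only [Finset.sum_insert hi, Partition.total_add, ih]

theorem IsPartitionLimit.const_mul {ψ : X → ℝ} {f : StrongDual ℝ X} (h : IsPartitionLimit ψ f)
    (c : ℝ) : IsPartitionLimit (fun y => c * ψ y) (c • f) := fun x hx => by
  have : ∀ π : Partition x, π.total (fun y => c * ψ y) = c * π.total ψ := fun π =>
    π.total_map (AddMonoidHom.mulLeft c) ψ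
  simp only [this]
  exact (h x hx).const_mul c

theorem IsPartitionLimit.add {ψ ψ' : X → ℝ} {f f' : StrongDual ℝ X} (h : IsPartitionLimit ψ f)
    (h' : IsPartitionLimit ψ' f') : IsPartitionLimit (fun y => ψ y + ψ' y) (f + f') := fun x hx => by
  simp only [Partition.total_add]
  exact (h x hx).add (h' x hx)

theorem ConeSubadditive.exists_isPartitionLimit_of_le {ψ : X → ℝ} (hψ : ConeSubadditive ψ)
    (h0 : ∀ y, 0 ≤ y → 0 ≤ ψ y) {g : StrongDual ℝ X} {K : ℝ} (hK : ∀ y, 0 ≤ y → ψ y ≤ K * g y) :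
    ∃ f : StrongDual ℝ X, IsPartitionLimit ψ f := by
  obtain ⟨f, hf, -⟩ := hψ.exists_isPartitionLimit h0 ‖K • g‖ fun x _ π => by
    refine (π.total_mono hK).trans ?_
    have := π.total_addMonoidHom ((K • g : StrongDual ℝ X) : X →+ ℝ)
    exact (le_of_eq this).trans ((le_abs_self _).trans ((K • g).le_opNorm x))
  exact ⟨f, hf⟩

/-- A series of positive functionals with bounded partial sums converges pointwise. -/
theorem exists_dual_hasSum {f : ℕ → StrongDual ℝ X} (hf : ∀ n, f n ∈ dualPosCone X) {C : ℝ}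
    (hC : ∀ (s : Finset ℕ) (x : X), 0 ≤ x → ∑ n ∈ s, f n x ≤ C * ‖x‖) :
    ∃ g : StrongDual ℝ X, ∀ x, 0 ≤ x → HasSum (fun n => f n x) (g x) := by
  have hs : ∀ x, 0 ≤ x → Summable fun n => f n x := fun x hx =>
    summable_of_sum_le (fun n => hf n x hx) fun s => hC s x hx
  obtain ⟨g, hg⟩ := exists_dual_of_additive (fun x => ∑' n, f n x) C
    (fun x hx => tsum_nonneg fun n => hf n x hx)
    (fun x hx => (hs x hx).tsum_le_of_sum_le fun s => hC s x hx) (fun x y hx hy => by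
      simp only [map_add]
      exact (hs x hx).tsum_add (hs y hy))
  exact ⟨g, fun x hx => by rw [hg x hx]; exact (hs x hx).hasSum⟩

/-- A series of rank one operators dominated by a functional converges to an operator. -/
theorem exists_clm_hasSum [CompleteSpace E] {f : ℕ → StrongDual ℝ X}
    (hf : ∀ n, f n ∈ dualPosCone X) {v : ℕ → E} {H : StrongDual ℝ X}
    (hH : ∀ x, 0 ≤ x → HasSum (fun n => ‖v n‖ * f n x) (H x)) :
    ∃ T : X →L[ℝ] E, ∀ x, HasSum (fun n => f n x • v n) (T x) := by
  have hb : ∀ x n, ‖f n x • v n‖ ≤ ‖v n‖ * f n |x| := fun x n => by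
    rw [norm_smul, mul_comm]
    exact mul_le_mul_of_nonneg_left (abs_apply_le (hf n) x) (norm_nonneg _)
  have hs : ∀ x, Summable fun n => f n x • v n := fun x =>
    Summable.of_norm_bounded (hH |x| (abs_nonneg x)).summable (hb x)
  let L : X →ₗ[ℝ] E :=
    { toFun := fun x => ∑' n, f n x • v n
      map_add' := fun x y => by
        simp only [map_add, add_smul]
        exact (hs x).tsum_add (hs y)
      map_smul' := fun c x => by
        simp only [map_smul, smul_assoc, RingHom.id_apply]
        exact (hs x).tsum_const_smul c }
  refine ⟨L.mkContinuous ‖H‖ fun x => ?_, fun x => (hs x).hasSum⟩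
  refine (tsum_of_norm_bounded (hH |x| (abs_nonneg x)) (hb x)).trans ?_
  refine (le_abs_self _).trans ((H.le_opNorm _).trans (le_of_eq ?_))
  rw [norm_abs_eq_norm]

end PartitionTotals

/-! ### Greedy approximation of a vector density -/

section Density

variable {X : Type*} [NormedAddCommGroup X] [Lattice X] [IsOrderedAddMonoid X] [HasSolidNorm X]
  [NormedSpace ℝ X] {E : Type*} [NormedAddCommGroup E] [NormedSpace ℝ E]

/-- `T` has an absolutely convergent representation by positive functionals below `g`. This
gives `T` a density with respect to `g`. -/
def HasDensity (g : StrongDual ℝ X) (T : X →L[ℝ] E) : Prop :=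
  ∃ (φ : ℕ → StrongDual ℝ X) (v : ℕ → E) (H : StrongDual ℝ X), (∀ n, φ n ∈ dualPosCone X) ∧
    (∀ n x, 0 ≤ x → φ n x ≤ g x) ∧ (∀ x, 0 ≤ x → HasSum (fun n => ‖v n‖ * φ n x) (H x)) ∧
    ∀ x, HasSum (fun n => φ n x • v n) (T x)

/-- The common bound `g` survives interleaving, so remainders stay within the class and the
approximation can be iterated. -/
theorem HasDensity.sub {g : StrongDual ℝ X} {T T' : X →L[ℝ] E} (h : HasDensity g T)
    (h' : HasDensity g T') : HasDensity g (T - T') := by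
  obtain ⟨φ, v, H, h1, h2, h3, h4⟩ := h
  obtain ⟨φ', v', H', h1', h2', h3', h4'⟩ := h'
  refine ⟨interleave φ φ', interleave v (fun n => -v' n), H + H', interleave_cases h1 h1',
    interleave_cases (P := fun f : StrongDual ℝ X => ∀ x, 0 ≤ x → f x ≤ g x) h2 h2',
    fun x hx => ?_, fun x => ?_⟩
  · have := hasSum_interleave (h3 x hx) (h3' x hx)
    rw [add_apply]
    convert this using 2 with n
    unfold interleave
    cases Equiv.natSumNatEquivNat.symm n <;> simp
  · have := hasSum_interleave (h4 x) (h4' x).neg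
    rw [sub_apply, sub_eq_add_neg]
    convert this using 2 with n
    unfold interleave
    cases Equiv.natSumNatEquivNat.symm n <;> simp

/-- The function `q` of the greedy partition of unity: it is at least `g`, and less than `2 g`
only where `T` is `2 ε g`-close to `g • d`. -/
def nearGauge (g : StrongDual ℝ X) (T : X →L[ℝ] E) (ε : ℝ) (d : E) (y : X) : ℝ :=
  max (‖T y - g y • d‖ / ε) (g y)

/-- The minuend of `greedyMin`. -/
def greedyPos (g : StrongDual ℝ X) (T : X →L[ℝ] E) (ε : ℝ) (d : ℕ → E) : ℕ → X → ℝ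
  | 0, y => 2 * g y
  | m + 1, y => greedyPos g T ε d m y + nearGauge g T ε (d m) y

/-- The subtrahend of `greedyMin`. -/
def greedyNeg (g : StrongDual ℝ X) (T : X →L[ℝ] E) (ε : ℝ) (d : ℕ → E) : ℕ → X → ℝ
  | 0, _ => 0
  | m + 1, y => max (greedyPos g T ε d m y) (nearGauge g T ε (d m) y + greedyNeg g T ε d m y)

/-- The minimum of `2 g` and the first `m` gauges, as a difference of subadditive functions. -/
def greedyMin (g : StrongDual ℝ X) (T : X →L[ℝ] E) (ε : ℝ) (d : ℕ → E) (m : ℕ) (y : X) : ℝ :=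
  greedyPos g T ε d m y - greedyNeg g T ε d m y

variable {g : StrongDual ℝ X} {T : X →L[ℝ] E} {ε : ℝ} {d : ℕ → E}

theorem greedyMin_zero (y : X) : greedyMin g T ε d 0 y = 2 * g y := by
  simp [greedyMin, greedyPos, greedyNeg]

/-- The identity `min (a - b) q = (a + q) - max a (q + b)` preserves differences of subadditive
functions. A minimum of subadditive functions need not be subadditive, so its totals are handled
through such differences. -/
theorem greedyMin_succ (m : ℕ) (y : X) :
    greedyMin g T ε d (m + 1) y = min (greedyMin g T ε d m y) (nearGauge g T ε (d m) y) := by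
  simp only [greedyMin, greedyPos, greedyNeg]
  rcases le_total (greedyPos g T ε d m y) (nearGauge g T ε (d m) y + greedyNeg g T ε d m y) with h | h
  · rw [max_eq_right h, min_eq_left (by linarith)]; ring
  · rw [max_eq_left h, min_eq_right (by linarith)]; ring

theorem greedyMin_succ_le (m : ℕ) (y : X) : greedyMin g T ε d (m + 1) y ≤ greedyMin g T ε d m y := by
  rw [greedyMin_succ]; exact min_le_left _ _

theorem greedyMin_antitone (y : X) : Antitone fun m => greedyMin g T ε d m y :=
  antitone_nat_of_succ_le fun m => greedyMin_succ_le m y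

theorem le_greedyMin (m : ℕ) {y : X} (hy : 0 ≤ g y) : g y ≤ greedyMin g T ε d m y := by
  induction m with
  | zero => rw [greedyMin_zero]; linarith
  | succ m ih => rw [greedyMin_succ]; exact le_min ih (le_max_right _ _)

theorem greedyMin_le (m : ℕ) (y : X) : greedyMin g T ε d m y ≤ 2 * g y := by
  rw [← greedyMin_zero (T := T) (ε := ε) (d := d)]
  exact greedyMin_antitone y (Nat.zero_le m)

theorem coneSubadditive_nearGauge (hε : 0 < ε) (d : E) : ConeSubadditive (nearGauge g T ε d) := by
  refine ⟨by simp [nearGauge], fun x y _ _ => max_le ?_ ?_⟩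
  · have h : ‖T (x + y) - g (x + y) • d‖ ≤ ‖T x - g x • d‖ + ‖T y - g y • d‖ := by
      rw [map_add, map_add, add_smul, add_sub_add_comm]
      exact norm_add_le _ _
    calc _ ≤ (‖T x - g x • d‖ + ‖T y - g y • d‖) / ε := by gcongr
      _ = ‖T x - g x • d‖ / ε + ‖T y - g y • d‖ / ε := add_div _ _ _
      _ ≤ _ := add_le_add (le_max_left _ _) (le_max_left _ _)
  · rw [map_add]
    exact add_le_add (le_max_right _ _) (le_max_right _ _)

theorem ConeSubadditive.add {ψ ψ' : X → ℝ} (h : ConeSubadditive ψ) (h' : ConeSubadditive ψ') :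
    ConeSubadditive fun y => ψ y + ψ' y :=
  ⟨by simp [h.1, h'.1], fun x y hx hy => by
    have := h.2 x y hx hy
    have := h'.2 x y hx hy
    beta_reduce
    linarith⟩

theorem ConeSubadditive.max {ψ ψ' : X → ℝ} (h : ConeSubadditive ψ) (h' : ConeSubadditive ψ') :
    ConeSubadditive fun y => max (ψ y) (ψ' y) :=
  ⟨by simp [h.1, h'.1], fun x y hx hy => max_le
    ((h.2 x y hx hy).trans (add_le_add (le_max_left _ _) (le_max_left _ _)))
    ((h'.2 x y hx hy).trans (add_le_add (le_max_right _ _) (le_max_right _ _)))⟩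

/-- These are the hypotheses under which totals converge along partitions; domination by multiples
of `g` keeps the totals bounded. -/
theorem greedy_properties (hg : g ∈ dualPosCone X) {C : ℝ} (hC : ∀ y, 0 ≤ y → ‖T y‖ ≤ C * g y)
    (hε : 0 < ε) (m : ℕ) :
    (ConeSubadditive (greedyPos g T ε d m) ∧ (∀ y, 0 ≤ y → 0 ≤ greedyPos g T ε d m y) ∧
      ∃ K, ∀ y, 0 ≤ y → greedyPos g T ε d m y ≤ K * g y) ∧
    (ConeSubadditive (greedyNeg g T ε d m) ∧ (∀ y, 0 ≤ y → 0 ≤ greedyNeg g T ε d m y) ∧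
      ∃ K, ∀ y, 0 ≤ y → greedyNeg g T ε d m y ≤ K * g y) := by
  have hq : ∀ (e : E) y, 0 ≤ y → nearGauge g T ε e y ≤ ((C + ‖e‖) / ε + 1) * g y := by
    intro e y hy
    have hgy : 0 ≤ g y := hg y hy
    have hT := hC y hy
    have hCg : 0 ≤ C * g y := (norm_nonneg _).trans hT
    have h1 : ‖T y - g y • e‖ ≤ (C + ‖e‖) * g y := by
      refine (norm_sub_le _ _).trans ?_
      rw [norm_smul, Real.norm_of_nonneg hgy]
      linarith
    have h2 : ‖T y - g y • e‖ / ε ≤ (C + ‖e‖) / ε * g y := by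
      rw [div_mul_eq_mul_div]; gcongr
    have h3 : 0 ≤ ‖T y - g y • e‖ / ε := by positivity
    rw [add_mul, one_mul]
    exact max_le (by linarith) (by linarith)
  have hq0 : ∀ (e : E) y, 0 ≤ y → 0 ≤ nearGauge g T ε e y := fun e y hy =>
    (hg y hy : 0 ≤ g y).trans (le_max_right _ _)
  induction m with
  | zero =>
    refine ⟨⟨⟨by simp [greedyPos], fun x y _ _ => by simp [greedyPos, mul_add]⟩, fun y hy =>
      mul_nonneg zero_le_two (hg y hy), 2, fun y _ => le_rfl⟩, ⟨⟨rfl, fun x y _ _ => by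
        simp [greedyNeg]⟩, fun y _ => le_rfl, 0, fun y _ => by simp [greedyNeg]⟩⟩
  | succ m ih =>
    obtain ⟨⟨h1, h2, K, h3⟩, ⟨h1', h2', K', h3'⟩⟩ := ih
    refine ⟨⟨h1.add (coneSubadditive_nearGauge hε (d m)), fun y hy =>
      add_nonneg (h2 y hy) (hq0 _ y hy), K + ((C + ‖d m‖) / ε + 1), fun y hy => ?_⟩,
      ⟨h1.max ((coneSubadditive_nearGauge hε (d m)).add h1'), fun y hy =>
        (h2 y hy).trans (le_max_left _ _), K + (((C + ‖d m‖) / ε + 1) + K'), fun y hy => ?_⟩⟩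
    · rw [add_mul]
      exact add_le_add (h3 y hy) (hq _ y hy)
    · have e1 := h3 y hy
      have e2 := hq (d m) y hy
      have e3 := h3' y hy
      have e4 := h2 y hy
      have e5 := hq0 (d m) y hy
      have e6 := h2' y hy
      rw [add_mul K, add_mul _ K']
      exact max_le (by linarith) (by linarith)

/-- The mean value estimates behind the greedy partition of unity. -/
theorem norm_sub_sum_le {t : ℝ} (ht : 0 ≤ t) {w : E} {C : ℝ} (hw : ‖w‖ ≤ C * t) {δ : ℝ}
    (hδ : 0 ≤ δ) (M : ℕ) {c : ℕ → ℝ} (hc0 : ∀ m, 0 ≤ c m) (hc : ∑ m ∈ Finset.range M, c m ≤ t)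
    (hcd : ∀ m, c m ≠ 0 → ‖w - t • d m‖ ≤ δ * t) :
    ‖w - ∑ m ∈ Finset.range M, c m • d m‖ ≤
        δ * t + C * (t - ∑ m ∈ Finset.range M, c m) ∧
      ∑ m ∈ Finset.range M, ‖d m‖ * c m ≤ ‖w‖ + δ * t := by
  set s := ∑ m ∈ Finset.range M, c m with hs
  have hs0 : 0 ≤ s := Finset.sum_nonneg fun m _ => hc0 m
  rcases ht.eq_or_lt with rfl | ht
  · have hz : ∀ m ∈ Finset.range M, c m = 0 := by
      have : s = 0 := le_antisymm hc hs0
      exact (Finset.sum_eq_zero_iff_of_nonneg fun m _ => hc0 m).1 this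
    have hw0 : ‖w‖ ≤ 0 := by simpa using hw
    have e1 : ∑ m ∈ Finset.range M, c m • d m = 0 :=
      Finset.sum_eq_zero fun m hm => by rw [hz m hm, zero_smul]
    have e2 : ∑ m ∈ Finset.range M, ‖d m‖ * c m = 0 :=
      Finset.sum_eq_zero fun m hm => by rw [hz m hm, mul_zero]
    have e3 : s = 0 := le_antisymm hc hs0
    rw [e1, e2, e3]
    simp only [sub_zero, mul_zero, add_zero]
    exact ⟨hw0, norm_nonneg _⟩
  · have hterm : ∀ m, c m * ‖w - t • d m‖ ≤ c m * (δ * t) := fun m => by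
      by_cases h : c m = 0
      · simp [h]
      · exact mul_le_mul_of_nonneg_left (hcd m h) (hc0 m)
    constructor
    · have e : t • (w - ∑ m ∈ Finset.range M, c m • d m) =
          (t - s) • w + ∑ m ∈ Finset.range M, c m • (w - t • d m) := by
        simp only [smul_sub, Finset.sum_sub_distrib, ← Finset.sum_smul, sub_smul, Finset.smul_sum,
          smul_comm t]
        rw [← hs]
        abel
      have h1 : t * ‖w - ∑ m ∈ Finset.range M, c m • d m‖ ≤ (t - s) * (C * t) + t * (δ * t) := by
        rw [← Real.norm_of_nonneg ht.le, ← norm_smul, e, Real.norm_of_nonneg ht.le]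
        refine (norm_add_le _ _).trans (add_le_add ?_ ?_)
        · rw [norm_smul, Real.norm_of_nonneg (sub_nonneg.2 hc)]
          exact mul_le_mul_of_nonneg_left hw (sub_nonneg.2 hc)
        · refine (norm_sum_le _ _).trans ((Finset.sum_le_sum fun m _ => ?_).trans
            ((Finset.sum_mul (Finset.range M) c (δ * t)).symm.le.trans
              (mul_le_mul_of_nonneg_right hc (by positivity))))
          rw [norm_smul, Real.norm_of_nonneg (hc0 m)]
          exact hterm m
      refine le_of_mul_le_mul_left (h1.trans (le_of_eq ?_)) ht
      ring
    · refine le_of_mul_le_mul_left ?_ ht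
      calc t * ∑ m ∈ Finset.range M, ‖d m‖ * c m
          ≤ ∑ m ∈ Finset.range M, c m * (‖w‖ + δ * t) := by
            rw [Finset.mul_sum]
            refine Finset.sum_le_sum fun m _ => ?_
            have h2 : t * ‖d m‖ ≤ ‖w‖ + ‖w - t • d m‖ := by
              have := norm_sub_norm_le (t • d m) w
              rw [norm_sub_rev, norm_smul, Real.norm_of_nonneg ht.le] at this
              linarith
            have h3 := mul_le_mul_of_nonneg_left h2 (hc0 m)
            have := hterm m
            linarith
        _ = s * (‖w‖ + δ * t) := (Finset.sum_mul _ _ _).symm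
        _ ≤ t * (‖w‖ + δ * t) := mul_le_mul_of_nonneg_right hc (by positivity)

/-- For a given density and a dense sequence the greedy minima converge to `g`. -/
theorem HasDensity.exists_approx (hT : HasDensity g T) (hg : g ∈ dualPosCone X)
    (hd : DenseRange d) (hε : 0 < ε) {x : X} (hx : 0 ≤ x) {η : ℝ} (hη : 0 < η) :
    ∃ (h : StrongDual ℝ X) (M : ℕ), h x ≤ η ∧ ∀ y, 0 ≤ y →
      ∀ m, M ≤ m → greedyMin g T ε d m y ≤ g y + h y := by
  obtain ⟨φ, v, H, h1, h2, h3, h4⟩ := hT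
  have htail : ∀ N y, 0 ≤ y → ‖T y - ∑ n ∈ Finset.range N, φ n y • v n‖ ≤
      H y - ∑ n ∈ Finset.range N, ‖v n‖ * φ n y := by
    intro N y hy
    have e1 := (hasSum_nat_add_iff' (f := fun n => φ n y • v n) N).2 (h4 y)
    have e2 := (hasSum_nat_add_iff' (f := fun n => ‖v n‖ * φ n y) N).2 (h3 y hy)
    rw [← e1.tsum_eq]
    refine tsum_of_norm_bounded e2 fun n => ?_
    rw [norm_smul, Real.norm_of_nonneg (h1 _ y hy), mul_comm]
  obtain ⟨N, hN⟩ : ∃ N, (H x - ∑ n ∈ Finset.range N, ‖v n‖ * φ n x) / ε < η := by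
    have := ((h3 x hx).tendsto_sum_nat.const_sub (H x)).div_const ε
    rw [sub_self, zero_div] at this
    exact (this.eventually (gt_mem_nhds hη)).exists
  -- Dividing by `g y` puts the coefficients `φ n y / g y` in `[0, 1]`. Compactness then lets
  -- finitely many `d m` approximate the truncated density uniformly in `y`.
  let K : Set E := (fun c : Fin N → ℝ => ∑ n, c n • v n) '' Set.Icc 0 1
  have hK : IsCompact K := isCompact_Icc.image (by fun_prop)
  obtain ⟨M, hM⟩ : ∃ M, ∀ u ∈ K, ∃ m < M, ‖u - d m‖ < ε := by
    have hcov : K ⊆ ⋃ m, Metric.ball (d m) ε := fun u _ => by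
      obtain ⟨m, hm⟩ := hd.exists_dist_lt u hε
      exact Set.mem_iUnion.2 ⟨m, hm⟩
    obtain ⟨s, hs⟩ := hK.elim_finite_subcover _ (fun m => Metric.isOpen_ball) hcov
    refine ⟨s.sup id + 1, fun u hu => ?_⟩
    obtain ⟨m, hm, hum⟩ := Set.mem_iUnion₂.1 (hs hu)
    exact ⟨m, Nat.lt_succ_of_le (Finset.le_sup (f := id) hm), by rwa [← dist_eq_norm]⟩
  -- Truncation costs at most the tail of the majorant, divided by `ε` as in the gauge.
  refine ⟨ε⁻¹ • (H - ∑ n ∈ Finset.range N, ‖v n‖ • φ n), M, ?_, fun y hy m hm => ?_⟩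
  · simp only [smul_apply, sub_apply, sum_apply, smul_eq_mul]
    rw [inv_mul_eq_div]
    exact hN.le
  · have hgy : 0 ≤ g y := hg y hy
    have hval : (ε⁻¹ • (H - ∑ n ∈ Finset.range N, ‖v n‖ • φ n)) y =
        (H y - ∑ n ∈ Finset.range N, ‖v n‖ * φ n y) / ε := by
      simp only [smul_apply, sub_apply, sum_apply, smul_eq_mul]
      rw [inv_mul_eq_div]
    rw [hval]
    have hτ := htail N y hy
    obtain ⟨k, hk, hkd⟩ : ∃ k < M, ‖∑ n ∈ Finset.range N, φ n y • v n - g y • d k‖ ≤ ε * g y := by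
      rcases hgy.eq_or_lt with h0 | h0
      · have hz : ∀ n, φ n y = 0 := fun n =>
          le_antisymm ((h2 n y hy).trans h0.ge) (h1 n y hy)
        obtain ⟨k, hk, -⟩ := hM (∑ n, (0 : Fin N → ℝ) n • v n)
          ⟨0, ⟨le_rfl, fun _ => zero_le_one⟩, rfl⟩
        exact ⟨k, hk, by simp [hz, ← h0]⟩
      · obtain ⟨k, hk, hkd⟩ := hM (∑ n : Fin N, (φ n y / g y) • v n)
          ⟨fun n => φ n y / g y, ⟨fun n => div_nonneg (h1 n y hy) hgy,
            fun n => (div_le_one h0).2 (h2 n y hy)⟩, rfl⟩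
        refine ⟨k, hk, ?_⟩
        have e : ∑ n ∈ Finset.range N, φ n y • v n - g y • d k =
            g y • (∑ n : Fin N, (φ n y / g y) • v n - d k) := by
          rw [smul_sub, Finset.smul_sum, Finset.sum_range]
          congr 1
          refine Finset.sum_congr rfl fun n _ => ?_
          rw [smul_smul, mul_div_cancel₀ _ h0.ne']
        rw [e, norm_smul, Real.norm_of_nonneg hgy, mul_comm]
        exact mul_le_mul_of_nonneg_right hkd.le hgy
    have hq : nearGauge g T ε (d k) y ≤
        g y + (H y - ∑ n ∈ Finset.range N, ‖v n‖ * φ n y) / ε := by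
      have hτ0 : 0 ≤ (H y - ∑ n ∈ Finset.range N, ‖v n‖ * φ n y) / ε :=
        div_nonneg ((norm_nonneg _).trans hτ) hε.le
      refine max_le ?_ (by linarith)
      rw [div_le_iff₀ hε, add_mul, div_mul_cancel₀ _ hε.ne']
      have := norm_sub_le_norm_sub_add_norm_sub (T y) (∑ n ∈ Finset.range N, φ n y • v n)
        (g y • d k)
      linarith
    refine le_trans ((greedyMin_antitone y (hk.trans_le hm : k + 1 ≤ m)).trans ?_) hq
    beta_reduce
    rw [greedyMin_succ]
    exact min_le_right _ _

/-- Splitting off a countably valued part of the density: the rest is small. -/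
theorem HasDensity.exists_step [CompleteSpace E] (hT : HasDensity g T) (hg : g ∈ dualPosCone X)
    (hd : DenseRange d) {C : ℝ} (hC : ∀ y, 0 ≤ y → ‖T y‖ ≤ C * g y) (hε : 0 < ε) :
    ∃ (f : ℕ → StrongDual ℝ X) (W : StrongDual ℝ X) (T' : X →L[ℝ] E),
      (∀ m, f m ∈ dualPosCone X) ∧ (∀ x, 0 ≤ x → HasSum (fun m => ‖d m‖ * f m x) (W x)) ∧
      (∀ x, HasSum (fun m => f m x • d m) (T' x)) ∧ HasDensity g (T - T') ∧
      (∀ x, 0 ≤ x → ‖(T - T') x‖ ≤ 2 * ε * g x) ∧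
      ∀ x, 0 ≤ x → ∀ V : ℝ, (∀ π : Partition x, π.total (fun y => ‖T y‖) ≤ V) →
        W x ≤ V + 2 * ε * g x := by
  have hlim : ∀ m, ∃ F : StrongDual ℝ X, IsPartitionLimit (greedyMin g T ε d m) F := by
    intro m
    obtain ⟨⟨h1, h2, K, h3⟩, ⟨h1', h2', K', h3'⟩⟩ := greedy_properties (d := d) hg hC hε m
    obtain ⟨f, hf⟩ := h1.exists_isPartitionLimit_of_le h2 h3
    obtain ⟨f', hf'⟩ := h1'.exists_isPartitionLimit_of_le h2' h3'
    exact ⟨f - f', hf.sub hf'⟩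
  choose F hF using hlim
  -- Successive drops of the greedy minimum form the partition of unity: `f m` is the mass assigned
  -- to the value `d m`, and it is carried where that value is a good approximation.
  let f : ℕ → StrongDual ℝ X := fun m => F m - F (m + 1)
  have hf : ∀ m, IsPartitionLimit
      (fun y => greedyMin g T ε d m y - greedyMin g T ε d (m + 1) y) (f m) :=
    fun m => (hF m).sub (hF (m + 1))
  have hgl := isPartitionLimit_self g
  have hfpos : ∀ m, f m ∈ dualPosCone X := fun m x hx => by
    have := (isPartitionLimit_self (0 : StrongDual ℝ X)).le_of_le (hf m)
      (fun y _ => sub_nonneg.2 (greedyMin_succ_le m y)) x hx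
    exact this
  have hfle : ∀ m x, 0 ≤ x → f m x ≤ g x := fun m => (hf m).le_of_le hgl fun y hy => by
    have := greedyMin_le (g := g) (T := T) (ε := ε) (d := d) m y
    have := le_greedyMin (g := g) (T := T) (ε := ε) (d := d) (m + 1) (hg y hy)
    linarith
  have hpt : ∀ (M : ℕ) y, 0 ≤ y →
      ‖T y - ∑ m ∈ Finset.range M,
          (greedyMin g T ε d m y - greedyMin g T ε d (m + 1) y) • d m‖ ≤
        2 * ε * g y + C * (greedyMin g T ε d M y - g y) ∧
      ∑ m ∈ Finset.range M,
          ‖d m‖ * (greedyMin g T ε d m y - greedyMin g T ε d (m + 1) y) ≤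
        ‖T y‖ + 2 * ε * g y := by
    intro M y hy
    have hsum : ∑ m ∈ Finset.range M,
        (greedyMin g T ε d m y - greedyMin g T ε d (m + 1) y) =
        2 * g y - greedyMin g T ε d M y := by
      rw [Finset.sum_range_sub', greedyMin_zero]
    have hM := le_greedyMin (g := g) (T := T) (ε := ε) (d := d) M (hg y hy)
    have := norm_sub_sum_le (d := d) (hg y hy : 0 ≤ g y) (hC y hy) (δ := 2 * ε) (by positivity) M
      (c := fun m => greedyMin g T ε d m y - greedyMin g T ε d (m + 1) y)
      (fun m => sub_nonneg.2 (greedyMin_succ_le m y)) (by rw [hsum]; linarith) (fun m hm => by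
        -- A strict drop is possible only when the new gauge is below the starting value `2 g`,
        -- which forces `2 ε g`-closeness to `g • d m`.
        have h1 : nearGauge g T ε (d m) y < 2 * g y := by
          by_contra! h
          refine hm ?_
          rw [greedyMin_succ, min_eq_left ((greedyMin_le m y).trans h), sub_self]
        have h2 := (le_max_left _ _).trans_lt h1
        rw [div_lt_iff₀ hε] at h2
        linarith)
    rw [hsum] at this
    refine ⟨this.1.trans (le_of_eq ?_), this.2⟩
    ring
  have hWbound : ∀ x, 0 ≤ x → ∀ V : ℝ, (∀ π : Partition x, π.total (fun y => ‖T y‖) ≤ V) →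
      ∀ M, ∑ m ∈ Finset.range M, ‖d m‖ * f m x ≤ V + 2 * ε * g x := by
    intro x hx V hV M
    have : Fact (0 ≤ x) := ⟨hx⟩
    have h1 : Tendsto (fun π : Partition x => ∑ m ∈ Finset.range M, ‖d m‖ *
        π.total (fun y => greedyMin g T ε d m y - greedyMin g T ε d (m + 1) y)) atTop
        (𝓝 (∑ m ∈ Finset.range M, ‖d m‖ * f m x)) :=
      tendsto_finsetSum _ fun m _ => (hf m x hx).const_mul _
    refine le_of_tendsto' h1 fun π => ?_
    have h2 : ∑ m ∈ Finset.range M, ‖d m‖ *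
        π.total (fun y => greedyMin g T ε d m y - greedyMin g T ε d (m + 1) y) =
        π.total (fun y => ∑ m ∈ Finset.range M,
          ‖d m‖ * (greedyMin g T ε d m y - greedyMin g T ε d (m + 1) y)) := by
      rw [π.total_finset_sum]
      refine Finset.sum_congr rfl fun m _ => ?_
      exact (π.total_map (AddMonoidHom.mulLeft ‖d m‖) _).symm
    rw [h2]
    refine (π.total_mono fun y hy => (hpt M y hy).2).trans ?_
    rw [π.total_add]
    have h3 : π.total (fun y => 2 * ε * g y) = 2 * ε * g x :=
      π.total_addMonoidHom (((2 * ε) • g : StrongDual ℝ X) : X →+ ℝ)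
    rw [h3]
    exact add_le_add (hV π) le_rfl
  have hVC : ∀ x, 0 ≤ x → ∀ π : Partition x, π.total (fun y => ‖T y‖) ≤ C * g x := by
    intro x _ π
    refine (π.total_mono hC).trans (le_of_eq ?_)
    exact π.total_addMonoidHom ((C • g : StrongDual ℝ X) : X →+ ℝ)
  have hWfin : ∀ (s : Finset ℕ) (x : X), 0 ≤ x →
      ∑ m ∈ s, (‖d m‖ • f m) x ≤ ‖(C + 2 * ε) • g‖ * ‖x‖ := by
    intro s x hx
    have h1 : ∑ m ∈ s, ‖d m‖ * f m x ≤ ∑ m ∈ Finset.range (s.sup id + 1), ‖d m‖ * f m x :=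
      Finset.sum_le_sum_of_subset_of_nonneg
        (fun m hm => Finset.mem_range.2 (Nat.lt_succ_of_le (Finset.le_sup (f := id) hm)))
        fun m _ _ => mul_nonneg (norm_nonneg _) (hfpos m x hx)
    refine h1.trans ((hWbound x hx _ (hVC x hx) _).trans ?_)
    rw [← add_mul]
    exact (le_abs_self _).trans (((C + 2 * ε) • g).le_opNorm x)
  obtain ⟨W, hW⟩ := exists_dual_hasSum (f := fun m => ‖d m‖ • f m)
    (fun m => dualPosCone_smul (hfpos m) (norm_nonneg _)) hWfin
  have hW' : ∀ x, 0 ≤ x → HasSum (fun m => ‖d m‖ * f m x) (W x) := hW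
  obtain ⟨T', hT'⟩ := exists_clm_hasSum hfpos hW'
  refine ⟨f, W, T', hfpos, hW', hT', hT.sub ⟨f, d, W, hfpos, hfle, hW', hT'⟩, fun x hx => ?_,
    fun x hx V hV => ?_⟩
  · have : Fact (0 ≤ x) := ⟨hx⟩
    -- The pointwise estimate summed over a partition passes to the limit; `T` is additive, so its
    -- total remains `T x`.
    have hstep : ∀ M, ‖T x - ∑ m ∈ Finset.range M, f m x • d m‖ ≤
        2 * ε * g x + C * (F M x - g x) := by
      intro M
      have h1 : Tendsto (fun π : Partition x => ‖T x - ∑ m ∈ Finset.range M,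
          π.total (fun y => greedyMin g T ε d m y - greedyMin g T ε d (m + 1) y) • d m‖) atTop
          (𝓝 ‖T x - ∑ m ∈ Finset.range M, f m x • d m‖) :=
        (tendsto_const_nhds.sub
          (tendsto_finsetSum _ fun m _ => (hf m x hx).smul_const (d m))).norm
      have h2 := ((hgl.const_mul (2 * ε)).add (((hF M).sub hgl).const_mul C)) x hx
      refine le_of_tendsto_of_tendsto' h1 h2 fun π => ?_
      have e : T x - ∑ m ∈ Finset.range M,
          π.total (fun y => greedyMin g T ε d m y - greedyMin g T ε d (m + 1) y) • d m =
          π.total (fun y => T y - ∑ m ∈ Finset.range M,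
            (greedyMin g T ε d m y - greedyMin g T ε d (m + 1) y) • d m) := by
        rw [π.total_sub, π.total_finset_sum]
        congr 1
        · exact (π.total_addMonoidHom (T : X →+ E)).symm
        · refine Finset.sum_congr rfl fun m _ => ?_
          exact (π.total_map ((AddMonoidHom.flip (smulAddHom ℝ E)) (d m)) _).symm
      rw [e]
      exact (π.norm_total_le _).trans (π.total_mono fun y hy => (hpt M y hy).1)
    have hFlim : Tendsto (fun M => F M x - g x) atTop (𝓝 0) := by
      rw [Metric.tendsto_atTop]
      intro η hη
      obtain ⟨h, M, hhx, hh⟩ := hT.exists_approx hg hd hε hx (half_pos hη)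
      refine ⟨M, fun m hm => ?_⟩
      have e1 := (hF m).le_of_le (hgl.add (isPartitionLimit_self h)) (fun y hy => hh y hy m hm) x hx
      have e2 := hgl.le_of_le (hF m) (fun y hy => le_greedyMin m (hg y hy)) x hx
      rw [add_apply] at e1
      rw [Real.dist_eq, sub_zero, abs_of_nonneg (sub_nonneg.2 e2)]
      linarith
    have h3 := (hT' x).tendsto_sum_nat.const_sub (T x) |>.norm
    have h4 := (hFlim.const_mul C).const_add (2 * ε * g x)
    rw [mul_zero, add_zero] at h4
    exact le_of_tendsto_of_tendsto' h3 h4 hstep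
  · exact le_of_tendsto' (hW' x hx).tendsto_sum_nat fun M => hWbound x hx V hV M

end Density

/-! ### Iteration to an exact series of almost minimal weight -/

section Iteration

variable {X : Type*} [NormedAddCommGroup X] [Lattice X] [IsOrderedAddMonoid X] [HasSolidNorm X]
  [NormedSpace ℝ X] {E : Type*} [NormedAddCommGroup E] [NormedSpace ℝ E]

/-- An operator with a density is the sum of a double series of rank one operators whose total
weight is almost the least possible. -/
theorem HasDensity.exists_double_series [CompleteSpace E] {g : StrongDual ℝ X} {T : X →L[ℝ] E}
    {d : ℕ → E} (hT : HasDensity g T) (hg : g ∈ dualPosCone X) (hd : DenseRange d) {C : ℝ}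
    (hC : ∀ y, 0 ≤ y → ‖T y‖ ≤ C * g y) {c : ℝ}
    (hc : ∀ x, 0 ≤ x → ∀ π : Partition x, π.total (fun y => ‖T y‖) ≤ c * ‖x‖) {ε : ℝ}
    (hε : 0 < ε) :
    ∃ f : ℕ × ℕ → StrongDual ℝ X, (∀ k, f k ∈ dualPosCone X) ∧
      (∀ x, HasSum (fun k => f k x • d k.2) (T x)) ∧
      ∀ x, 0 ≤ x → ∀ s : Finset (ℕ × ℕ),
        ∑ k ∈ s, ‖d k.2‖ * f k x ≤ c * ‖x‖ + 8 * ε * g x := by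
  -- The state carries what the next step needs: a density and a bound by a multiple of `g`. The
  -- tolerances `ε / 2^j` make later weights summable.
  let σ := {S : X →L[ℝ] E // HasDensity g S ∧ ∃ C, ∀ y, 0 ≤ y → ‖S y‖ ≤ C * g y}
  let e : ℕ → ℝ := fun j => ε / 2 ^ j
  have he : ∀ j, 0 < e j := fun j => by positivity
  have hstep : ∀ (j : ℕ) (S : σ), ∃ (f : ℕ → StrongDual ℝ X) (W : StrongDual ℝ X)
      (T' : X →L[ℝ] E), (∀ m, f m ∈ dualPosCone X) ∧
      (∀ x, 0 ≤ x → HasSum (fun m => ‖d m‖ * f m x) (W x)) ∧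
      (∀ x, HasSum (fun m => f m x • d m) (T' x)) ∧ HasDensity g (S.1 - T') ∧
      (∀ x, 0 ≤ x → ‖(S.1 - T') x‖ ≤ 2 * e j * g x) ∧
      ∀ x, 0 ≤ x → ∀ V : ℝ, (∀ π : Partition x, π.total (fun y => ‖S.1 y‖) ≤ V) →
        W x ≤ V + 2 * e j * g x := fun j S => by
    obtain ⟨C, hC⟩ := S.2.2
    exact S.2.1.exists_step hg hd hC (he j)
  choose f W T' hf hW hT' hD hsmall hWV using hstep
  let next : ℕ → σ → σ := fun j S => ⟨S.1 - T' j S, hD j S, 2 * e j, hsmall j S⟩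
  let R : ℕ → σ := fun j => Nat.rec ⟨T, hT, C, hC⟩ next j
  have hR0 : (R 0).1 = T := rfl
  have hRs : ∀ j, (R (j + 1)).1 = (R j).1 - T' j (R j) := fun j => rfl
  have hRsmall : ∀ j x, 0 ≤ x → ‖(R (j + 1)).1 x‖ ≤ 2 * e j * g x := fun j => hsmall j (R j)
  let w : ℕ → X → ℝ := fun j x => W j (R j) x
  have hw0 : ∀ j x, 0 ≤ x → 0 ≤ w j x := fun j x hx =>
    (hW j (R j) x hx).nonneg fun m => mul_nonneg (norm_nonneg _) (hf j (R j) m x hx)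
  have hwzero : ∀ x, 0 ≤ x → w 0 x ≤ c * ‖x‖ + 2 * e 0 * g x := fun x hx =>
    hWV 0 (R 0) x hx _ (hc x hx)
  -- The remainder contributes variation `2 e j`, and its approximation `2 e (j + 1) = e j`. With `2
  -- ε` from the first step and `3 · 2 ε` from the later ones, the excess is `8 ε`.
  have hwsucc : ∀ j x, 0 ≤ x → w (j + 1) x ≤ 3 * e j * g x := by
    intro j x hx
    have h1 := hWV (j + 1) (R (j + 1)) x hx (2 * e j * g x) fun π => by
      refine (π.total_mono (hRsmall j)).trans (le_of_eq ?_)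
      exact π.total_addMonoidHom (((2 * e j) • g : StrongDual ℝ X) : X →+ ℝ)
    have h2 : e (j + 1) = e j / 2 := by simp only [e, pow_succ]; field_simp
    rw [h2] at h1
    refine h1.trans (le_of_eq ?_)
    ring
  have hesum : HasSum e (2 * ε) := by
    have := (hasSum_geometric_two).mul_left ε
    rw [mul_comm 2 ε]
    have h : e = fun j => ε * (1 / 2) ^ j := funext fun j => by simp [e, div_eq_mul_inv]
    rwa [h]
  have hwsum : ∀ x, 0 ≤ x → Summable (fun j => w j x) ∧
      ∑' j, w j x ≤ c * ‖x‖ + 8 * ε * g x := by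
    intro x hx
    have h1 : HasSum (fun j => 3 * e j * g x) (3 * (2 * ε) * g x) :=
      (hesum.mul_left 3).mul_right (g x)
    have h2 : Summable fun j => w (j + 1) x :=
      Summable.of_nonneg_of_le (fun j => hw0 (j + 1) x hx) (fun j => hwsucc j x hx) h1.summable
    have h3 : Summable fun j => w j x := (summable_nat_add_iff 1).1 h2
    refine ⟨h3, ?_⟩
    rw [h3.tsum_eq_zero_add]
    have h4 := h2.tsum_le_tsum (fun j => hwsucc j x hx) h1.summable
    rw [h1.tsum_eq] at h4
    have h5 := hwzero x hx
    have h6 : e 0 = ε := by simp [e]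
    rw [h6] at h5
    linarith
  let F : ℕ × ℕ → StrongDual ℝ X := fun k => f k.1 (R k.1) k.2
  have hF : ∀ k, F k ∈ dualPosCone X := fun k => hf k.1 (R k.1) k.2
  have hFs : ∀ x, 0 ≤ x → Summable fun k : ℕ × ℕ => ‖d k.2‖ * F k x := by
    intro x hx
    refine (summable_prod_of_nonneg fun k => mul_nonneg (norm_nonneg _) (hF k x hx)).2
      ⟨fun j => (hW j (R j) x hx).summable, ?_⟩
    refine (hwsum x hx).1.congr fun j => ?_
    exact (hW j (R j) x hx).tsum_eq.symm
  refine ⟨F, hF, fun x => ?_, fun x hx s => ?_⟩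
  · have hs : Summable fun k : ℕ × ℕ => F k x • d k.2 := by
      refine Summable.of_norm_bounded (hFs |x| (abs_nonneg x)) fun k => ?_
      rw [norm_smul, mul_comm]
      exact mul_le_mul_of_nonneg_left (abs_apply_le (hF k) x) (norm_nonneg _)
    have h1 : HasSum (fun j => T' j (R j) x) (∑' k : ℕ × ℕ, F k x • d k.2) :=
      hs.hasSum.prod_fiberwise fun j => hT' j (R j) x
    have h2 : ∀ J, ∑ j ∈ Finset.range J, T' j (R j) x = T x - (R J).1 x := by
      intro J
      induction J with
      | zero => simp [hR0]
      | succ J ih =>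
        rw [Finset.sum_range_succ, ih, hRs, sub_apply]
        abel
    have h3 : Tendsto (fun J => (R J).1 x) atTop (𝓝 0) := by
      rw [← tendsto_add_atTop_iff_nat 1]
      have h4 : Tendsto (fun j => 2 * e j * g x⁺ + 2 * e j * g x⁻) atTop (𝓝 0) := by
        have h5 := hesum.summable.tendsto_atTop_zero
        have h6 := ((h5.const_mul 2).mul_const (g x⁺)).add ((h5.const_mul 2).mul_const (g x⁻))
        simpa using h6
      refine squeeze_zero_norm (fun j => ?_) h4
      have h7 : (R (j + 1)).1 x = (R (j + 1)).1 x⁺ - (R (j + 1)).1 x⁻ := by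
        rw [← map_sub, posPart_sub_negPart]
      rw [h7]
      exact (norm_sub_le _ _).trans (add_le_add (hRsmall j _ (posPart_nonneg x))
        (hRsmall j _ (negPart_nonneg x)))
    have h4 := h1.tendsto_sum_nat
    simp only [h2] at h4
    have h5 := tendsto_nhds_unique h4 (h3.const_sub (T x))
    rw [sub_zero] at h5
    rw [← h5]
    exact hs.hasSum
  · refine ((hFs x hx).sum_le_tsum s fun k _ => mul_nonneg (norm_nonneg _) (hF k x hx)).trans ?_
    rw [(hFs x hx).tsum_prod' fun j => (hW j (R j) x hx).summable]
    refine le_trans (le_of_eq (tsum_congr fun j => ?_)) (hwsum x hx).2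
    exact (hW j (R j) x hx).tsum_eq

/-- An operator with a density is positively `∞`-nuclear with norm at most its cone absolutely
summing norm. -/
theorem HasDensity.exists_rep [CompleteSpace E] {g : StrongDual ℝ X} {T : X →L[ℝ] E}
    {d : ℕ → E} (hT : HasDensity g T) (hg : g ∈ dualPosCone X) (hd : DenseRange d) {C : ℝ}
    (hC : ∀ y, 0 ≤ y → ‖T y‖ ≤ C * g y) {c : ℝ} (hc0 : 0 ≤ c)
    (hc : ∀ x, 0 ≤ x → ∀ π : Partition x, π.total (fun y => ‖T y‖) ≤ c * ‖x‖) {ε : ℝ}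
    (hε : 0 < ε) :
    ∃ (f : ℕ → StrongDual ℝ X) (a : ℕ → E), IsPosNuclearRep ∞ T f a ∧
      weakNorm (ENNReal.conjExponent ∞) f ≤ ENNReal.ofReal (c + 8 * ε * ‖g‖) ∧
      strongNorm ∞ a ≤ 1 := by
  obtain ⟨F, hF, hFT, hFs⟩ := hT.exists_double_series hg hd hC hc hε
  let i : ℕ ≃ ℕ × ℕ := Nat.pairEquiv.symm
  -- All weight moves to the functionals and the vectors are normalized. If `d` vanishes at an
  -- index, the convention `0⁻¹ = 0` makes that term zero on both sides.
  let f : ℕ → StrongDual ℝ X := fun n => ‖d (i n).2‖ • F (i n)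
  let a : ℕ → E := fun n => ‖d (i n).2‖⁻¹ • d (i n).2
  have e1 : ENNReal.conjExponent ∞ = 1 := by simp [ENNReal.conjExponent]
  have hpos : ∀ n, f n ∈ dualPosCone X := fun n => dualPosCone_smul (hF _) (norm_nonneg _)
  have hweak : weakNorm (ENNReal.conjExponent ∞) f ≤ ENNReal.ofReal (c + 8 * ε * ‖g‖) := by
    rw [e1]
    refine weakNorm_one_le hpos (by positivity) fun s x hx => ?_
    have h1 := hFs x hx (s.map i.toEmbedding)
    rw [Finset.sum_map] at h1
    have h2 : g x ≤ ‖g‖ * ‖x‖ := (le_abs_self _).trans (g.le_opNorm x)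
    have h3 := mul_le_mul_of_nonneg_left h2 (show 0 ≤ 8 * ε by positivity)
    refine le_trans (le_of_eq ?_) (h1.trans (by linarith))
    exact Finset.sum_congr rfl fun n _ => rfl
  have hstrong : strongNorm ∞ a ≤ 1 := by
    rw [strongNorm_top]
    refine iSup_le fun n => ?_
    rw [← ofReal_norm, ENNReal.ofReal_le_one, norm_smul, norm_inv, norm_norm]
    exact inv_mul_le_one
  refine ⟨f, a, ⟨hpos, hweak.trans_lt ENNReal.ofReal_lt_top,
    hstrong.trans_lt ENNReal.one_lt_top, fun x => ?_⟩, hweak, hstrong⟩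
  have h := (i.hasSum_iff (f := fun k : ℕ × ℕ => F k x • d k.2)).2 (hFT x)
  convert h using 2 with n
  change (‖d (i n).2‖ * F (i n) x) • ‖d (i n).2‖⁻¹ • d (i n).2 = F (i n) x • d (i n).2
  rw [smul_smul]
  rcases eq_or_ne (d (i n).2) 0 with h0 | h0
  · simp [h0]
  · rw [mul_right_comm, mul_inv_cancel₀ (norm_ne_zero_iff.2 h0), one_mul]

end Iteration

/-! ### The nuclear norm at the infinite exponent -/

section Infinity

variable {X : Type u} {E : Type v} [NormedAddCommGroup X] [Lattice X] [IsOrderedAddMonoid X]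
  [HasSolidNorm X] [NormedSpace ℝ X] [IsOrderedModule ℝ X] [NormedAddCommGroup E]
  [NormedSpace ℝ E] [CompleteSpace E]

/-- A positively `∞`-nuclear representation yields a density, once the range space is cut down
to a separable one. -/
theorem IsPosNuclearRep.posNuclearNorm_le_of_total_le {T : X →L[ℝ] E} {f : ℕ → StrongDual ℝ X}
    {a : ℕ → E} (h : IsPosNuclearRep ∞ T f a) {c : ℝ} (hc0 : 0 ≤ c)
    (hc : ∀ x, 0 ≤ x → ∀ π : Partition x, π.total (fun y => ‖T y‖) ≤ c * ‖x‖) :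
    posNuclearNorm ∞ T ≤ ENNReal.ofReal c := by
  -- The greedy construction needs a dense sequence of values; the closed span of the `a n` is
  -- separable and contains the range of `T`.
  let E₀ : Submodule ℝ E := (Submodule.span ℝ (Set.range a)).topologicalClosure
  have hE₀ : IsClosed (E₀ : Set E) := Submodule.isClosed_topologicalClosure _
  have : CompleteSpace E₀ := hE₀.completeSpace_coe
  have hsep : TopologicalSpace.SeparableSpace E₀ := by
    have h1 : TopologicalSpace.IsSeparable (E₀ : Set E) :=
      ((Set.countable_range a).isSeparable.span (R := ℝ)).closure
    exact h1.separableSpace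
  have ha : ∀ n, a n ∈ E₀ := fun n =>
    Submodule.le_topologicalClosure _ (Submodule.subset_span ⟨n, rfl⟩)
  have hT : ∀ x, T x ∈ E₀ := fun x =>
    hE₀.mem_of_tendsto (h.hasSum x).tendsto_sum_nat (Eventually.of_forall fun N =>
      Submodule.sum_mem _ fun n _ => Submodule.smul_mem _ _ (ha n))
  let T₀ : X →L[ℝ] E₀ := T.codRestrict E₀ hT
  let a₀ : ℕ → E₀ := fun n => ⟨a n, ha n⟩
  have e1 : ENNReal.conjExponent ∞ = 1 := by simp [ENNReal.conjExponent]
  have hw := h.weak_lt_top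
  rw [e1] at hw
  obtain ⟨w, hw, -⟩ := ENNReal.lt_iff_exists_coe.1 hw
  obtain ⟨M, hM, -⟩ := ENNReal.lt_iff_exists_coe.1 h.strong_lt_top
  have haM : ∀ n, ‖a n‖ ≤ M := fun n => by
    have h1 := le_iSup (fun n => ‖a n‖ₑ) n
    rw [← strongNorm_top, hM] at h1
    exact_mod_cast h1
  have hfw : ∀ (s : Finset ℕ) (x : X), 0 ≤ x → ∑ n ∈ s, f n x ≤ w * ‖x‖ := by
    intro s x hx
    have h1 := (ENNReal.sum_le_tsum s).trans (tsum_enorm_apply_le f x)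
    rw [hw] at h1
    have h2 : ∑ n ∈ s, ‖f n x‖ₑ = ENNReal.ofReal (∑ n ∈ s, f n x) := by
      rw [ENNReal.ofReal_sum_of_nonneg fun n _ => h.pos n x hx]
      exact Finset.sum_congr rfl fun n _ => by
        rw [← ofReal_norm, Real.norm_of_nonneg (h.pos n x hx)]
    rw [h2, ← ofReal_norm, ← ENNReal.ofReal_coe_nnreal, ← ENNReal.ofReal_mul (norm_nonneg x),
      ENNReal.ofReal_le_ofReal_iff (by positivity), mul_comm] at h1
    exact h1
  obtain ⟨g, hg⟩ := exists_dual_hasSum h.pos hfw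
  have hgpos : g ∈ dualPosCone X := fun x hx => (hg x hx).nonneg fun n => h.pos n x hx
  have hfg : ∀ n x, 0 ≤ x → f n x ≤ g x := fun n x hx =>
    le_hasSum (hg x hx) n fun m _ => h.pos m x hx
  have ha₀ : ∀ n, ‖a₀ n‖ ≤ M := haM
  obtain ⟨H, hH⟩ := exists_dual_hasSum (f := fun n => ‖a₀ n‖ • f n) (C := M * w)
    (fun n => dualPosCone_smul (h.pos n) (norm_nonneg _)) (fun s x hx => by
      have h1 : ∑ n ∈ s, (‖a₀ n‖ • f n) x ≤ M * ∑ n ∈ s, f n x := by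
        rw [Finset.mul_sum]
        exact Finset.sum_le_sum fun n _ =>
          mul_le_mul_of_nonneg_right (ha₀ n) (h.pos n x hx)
      refine h1.trans ?_
      rw [mul_assoc]
      exact mul_le_mul_of_nonneg_left (hfw s x hx) M.coe_nonneg)
  have hsum₀ : ∀ x, HasSum (fun n => f n x • a₀ n) (T₀ x) := fun x => by
    have hind : Topology.IsInducing (E₀.subtype : E₀ → E) := Topology.IsInducing.subtypeVal
    exact (hind.hasSum_iff (g := E₀.subtype) _ _).1 (h.hasSum x)
  have hdens : HasDensity g T₀ := ⟨f, a₀, H, h.pos, hfg, hH, hsum₀⟩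
  have hbound : ∀ y, 0 ≤ y → ‖T₀ y‖ ≤ M * g y := by
    intro y hy
    rw [← (hsum₀ y).tsum_eq]
    refine tsum_of_norm_bounded ((hg y hy).mul_left (M : ℝ)) fun n => ?_
    rw [norm_smul, Real.norm_of_nonneg (h.pos n y hy), mul_comm]
    exact mul_le_mul_of_nonneg_right (ha₀ n) (h.pos n y hy)
  refine ENNReal.le_of_forall_pos_le_add fun δ hδ _ => ?_
  set ε : ℝ := δ / (8 * (‖g‖ + 1)) with hε
  have hε0 : 0 < ε := by positivity
  obtain ⟨f', a', hrep, h1, h2⟩ := hdens.exists_rep hgpos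
    (TopologicalSpace.denseRange_denseSeq E₀) hbound hc0 hc hε0
  -- The inclusion of `E₀` carries the representation back to `E` without increasing the strong
  -- norm.
  obtain ⟨h0, h3, h4⟩ := hrep.comp (Y := X) (S := ContinuousLinearMap.id ℝ X) (F := E) le_top
    (fun y hy => hy) E₀.subtypeL
  have e2 : E₀.subtypeL.comp (T₀.comp (ContinuousLinearMap.id ℝ X)) = T := by
    ext x; rfl
  rw [e2] at h0
  have h5 : strongNorm ∞ (fun n => E₀.subtypeL (a' n)) ≤ 1 :=
    (strongNorm_mono le_top fun n => le_rfl).trans h2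
  have h6 : (fun n => (f' n).comp (ContinuousLinearMap.id ℝ X)) = f' := by
    funext n; ext x; rfl
  refine h0.posNuclearNorm_le.trans ?_
  rw [h6]
  refine (mul_le_mul' h1 h5).trans ?_
  rw [mul_one, ENNReal.ofReal_add hc0 (by positivity)]
  gcongr
  rw [← ENNReal.ofReal_coe_nnreal]
  refine ENNReal.ofReal_le_ofReal ?_
  have : 8 * ε * (‖g‖ + 1) = δ := by rw [hε]; field_simp
  linarith

end Infinity

end

end PosNuclear


/-! ### Equality of the two norms -/

theorem theorem3p4 {X : Type u} {E : Type v}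
    [NormedAddCommGroup X] [Lattice X] [IsOrderedAddMonoid X] [HasSolidNorm X]
    [NormedSpace ℝ X] [IsOrderedModule ℝ X] [CompleteSpace X]
    [NormedAddCommGroup E] [NormedSpace ℝ E] [CompleteSpace E]
    (p : ℝ≥0∞) (hp : 1 ≤ p)
    (hX : PosNuclear.HasPMAP (StrongDual ℝ X) (PosNuclear.dualPosCone X))
    (hE : PosNuclear.HasMAP E) (T : X →L[ℝ] E) (hT : PosNuclear.IsPosNuclear p T) :
    PosNuclear.IsPosIntegral p T ∧
      PosNuclear.posNuclearNorm p T = PosNuclear.posIntegralNorm p T := by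
  -- The extra `δ` keeps the constant strictly positive, as a bound must be, even when the product
  -- of the norms is zero.
  have key : ∀ (f : ℕ → StrongDual ℝ X) (a : ℕ → E), PosNuclear.IsPosNuclearRep p T f a →
      ∀ δ : ℝ≥0, 0 < δ → PosNuclear.IsPosIntegralBound p T
        ((PosNuclear.weakNorm p.conjExponent f * PosNuclear.strongNorm p a).toReal + δ) := by
    intro f a h δ hδ
    refine ⟨by positivity, ?_⟩
    intro Y _ _ _ _ _ _ _ F _ _ _ S R _ hS _
    have hfin := (ENNReal.mul_lt_top h.weak_lt_top h.strong_lt_top).ne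
    refine (PosNuclear.posNuclearNorm_comp_le hp h hS R).trans ?_
    rw [← ENNReal.ofReal_toReal hfin, ← ofReal_norm, ← ofReal_norm,
      ← ENNReal.ofReal_mul (norm_nonneg _), ← ENNReal.ofReal_mul (by positivity)]
    refine ENNReal.ofReal_le_ofReal ?_
    rw [ENNReal.toReal_ofReal ENNReal.toReal_nonneg, mul_assoc _ ‖R‖, mul_comm]
    gcongr
    exact le_add_of_nonneg_right δ.coe_nonneg
  refine ⟨?_, le_antisymm ?_ ?_⟩
  · obtain ⟨f, a, h⟩ := hT
    exact ⟨_, key f a h 1 one_pos⟩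
  · refine le_iInf fun C => le_iInf fun hC => ?_
    by_cases hp' : p = ∞
    · subst hp'
      obtain ⟨f, a, h⟩ := hT
      exact h.posNuclearNorm_le_of_total_le hC.1.le fun x _ π =>
        PosNuclear.total_norm_le_of_bound hE hC π
    · exact PosNuclear.posNuclearNorm_le_of_hasBalancedRep hC.1.le fun s hs =>
        PosNuclear.hasBalancedRep_of_bound hp hp' hX hE hT hC hs
  · refine le_iInf fun f => le_iInf fun a => le_iInf fun h => ?_
    refine ENNReal.le_of_forall_pos_le_add fun δ hδ hlt => ?_
    refine (iInf₂_le _ (key f a h δ hδ)).trans ?_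
    rw [ENNReal.ofReal_add ENNReal.toReal_nonneg δ.coe_nonneg, ENNReal.ofReal_toReal hlt.ne,
      ENNReal.ofReal_coe_nnreal]
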